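/- Let $p\ge 3$ be a prime and let $G=(\mathbb{F}_p\times\mathbb{F}_p)\rtimes\mathbb{F}_p^{*}$, where each $a\in\mathbb{F}_p^{*}$ acts on $\mathbb{F}_p\times\mathbb{F}_p$ as the matrix $\mathrm{diag}(a,a^{-1})$. Let $V$ be a finite dimensional $\mathbb{F}_pG$-module. A lift of $V$ over a complete local commutative Noetherian ring $S$ with residue field $\mathbb{F}_p$ is a pair $(M,\varphi)$, where $M$ is an $SG$-module that is free and finitely generated over $S$ and $\varphi:\mathbb{F}_p\otimes_S M\to V$ is an isomorphism of $\mathbb{F}_pG$-modules; an isomorphism of lifts $(M,\varphi)\to(M',\varphi')$ is an isomorphism $f:M\to M'$ of $SG$-modules with $\varphi'\circ(\mathrm{id}\otimes f)=\varphi$. A universal deformation ring $R(G,V)$ of $V$ is a complete local commutative Noetherian ring with residue field $\mathbb{F}_p$ carrying a lift $U$ of $V$ such that, for every such ring $S$, every lift of $V$ over $S$ is isomorphic to the base change of $U$ along a unique local ring homomorphism $R(G,V)\to S$. Then there exists a uniserial $\mathbb{F}_pG$-module $V$ of composition length $p-1$ with $\mathrm{End}_{\mathbb{F}_pG}(V)\cong\mathbb{F}_p$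 which has a universal deformation ring $R(G,V)$, and $$R(G,V)\cong\mathbb{Z}_p[[t]]/(pt).$$ In particular, $R(G,V)/pR(G,V)\cong\mathbb{F}_p[[t]]$ is infinite dimensional over $\mathbb{F}_p$. -/

import Mathlib

open scoped TensorProduct PowerSeries

universe u v

/-- A module is uniserial if its submodules are linearly ordered by inclusion. -/
def IsUniserialModule (A M : Type*) [Ring A] [AddCommGroup M] [Module A M] : Prop :=
  ∀ N₁ N₂ : Submodule A M, N₁ ≤ N₂ ∨ N₂ ≤ N₁

/-- The action of `F_p^*` on `F_p × F_p` in which `a` acts by the matrix `diag(a, a⁻¹)`. -/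
def diagAction (p : ℕ) :
    (ZMod p)ˣ →* MulAut (Multiplicative (ZMod p × ZMod p)) where
  toFun a := AddEquiv.toMultiplicative
    { toFun := fun v => ((a : ZMod p) * v.1, ((a⁻¹ : (ZMod p)ˣ) : ZMod p) * v.2)
      invFun := fun v => (((a⁻¹ : (ZMod p)ˣ) : ZMod p) * v.1, (a : ZMod p) * v.2)
      left_inv := fun v => by ext <;> simp
      right_inv := fun v => by ext <;> simp
      map_add' := fun v w => by ext <;> simp [mul_add] }
  map_one' := by
    ext v : 1
    apply Multiplicative.toAdd.injective
    ext <;> simp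
  map_mul' a b := by
    ext v : 1
    apply Multiplicative.toAdd.injective
    ext <;> simp [mul_assoc, mul_comm, mul_left_comm]

/-- The group `(F_p × F_p) ⋊ F_p^*`. -/
abbrev DiagGroup (p : ℕ) : Type :=
  SemidirectProduct (Multiplicative (ZMod p × ZMod p)) (ZMod p)ˣ (diagAction p)

/-- `R` is a complete local commutative Noetherian ring with residue field `k`, the
identification of the residue field with `k` being given by the structure map `R → k`. -/
class IsCoefficientRing (k : Type*) (R : Type*) [Field k] [CommRing R] [Algebra R k] : Prop
    extends IsLocalRing R, IsNoetherianRing R where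
  residue_surjective : Function.Surjective (algebraMap R k)
  complete : IsAdicComplete (IsLocalRing.maximalIdeal R) R

section Deformations

variable {k G V : Type*} [Field k] [Group G] [AddCommGroup V] [Module k V]

/-- A lift of `V` over `R`: an `RG`-module `M`, free and finitely generated over `R`, together
with an isomorphism of `kG`-modules `φ : k ⊗_R M ≅ V`. -/
structure DefLift (ρ : Representation k G V) (R : Type*) [CommRing R] [Algebra R k] where
  M : Type u
  [addCommGroup : AddCommGroup M]
  [module : Module R M]
  [free : Module.Free R M]
  [finite : Module.Finite R M]
  rep : Representation R G M
  φ : k ⊗[R] M ≃ₗ[k] V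
  equivariant : ∀ (g : G) (c : k) (m : M), φ (c ⊗ₜ[R] rep g m) = ρ g (φ (c ⊗ₜ[R] m))

attribute [instance] DefLift.addCommGroup DefLift.module DefLift.free DefLift.finite

/-- The lift `L` over `S` is isomorphic, as a lift of `V`, to the base change along `α : R → S`
of the lift `U` over `R`: there is an isomorphism of `SG`-modules `S ⊗_R U ≅ L` which is
compatible with the identifications of both reductions to `k` with `V`
(by `k`-linearity it suffices to compare them on the elements `1 ⊗ (1 ⊗ m)`). -/
def DefLift.ArisesFrom {ρ : Representation k G V} {R S : Type*} [CommRing R] [Algebra R k]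
    [CommRing S] [Algebra S k] (L : DefLift ρ S) (U : DefLift ρ R) (α : R →+* S) : Prop :=
  letI : Algebra R S := α.toAlgebra
  ∃ e : S ⊗[R] U.M ≃ₗ[S] L.M,
    (∀ (g : G) (s : S) (m : U.M), e (s ⊗ₜ[R] U.rep g m) = L.rep g (e (s ⊗ₜ[R] m))) ∧
    ∀ m : U.M, L.φ ((1 : k) ⊗ₜ[S] e ((1 : S) ⊗ₜ[R] m)) = U.φ ((1 : k) ⊗ₜ[R] m)

/-- `R` is a universal deformation ring of `V`: it carries a lift `U` of `V` such that every
lift of `V` over a complete local commutative Noetherian ring `S` with residue field `k` is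
isomorphic to the base change of `U` along a unique morphism `R → S`. Morphisms are ring
homomorphisms inducing the identity on `k`; these are automatically local and continuous, and,
when `k` is perfect of positive characteristic, linear over the Witt vectors of `k`. -/
def IsUniversalDeformationRing (ρ : Representation k G V) (R : Type u) [CommRing R]
    [Algebra R k] : Prop :=
  IsCoefficientRing k R ∧
    ∃ U : DefLift.{u} ρ R,
      ∀ (S : Type v) [CommRing S] [Algebra S k] [IsCoefficientRing k S] (L : DefLift.{v} ρ S),
        ∃! α : R →+* S, (algebraMap S k).comp α = algebraMap R k ∧ L.ArisesFrom U α

end Deformations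

/-!
Write `π = ζ - 1`. The module `V` is `F_p[ζ] = F_p[π] / (π ^ (p - 1))`, on which `(1, 0)` acts as
multiplication by `ζ`, `(0, 1)` acts trivially, and `F_p^*` acts as the Galois group.

In a lift `M` over `S`, averaging over `F_p^*`, whose order is prime to `p`, produces a fixed
vector lifting `1 ∈ V`, and by Nakayama it is a cyclic vector for the action `x` of `(1, 0)`.
Since `x` is conjugate to `x ^ 2`, its determinant is `1`; together with `x ^ p = 1` this forces
its characteristic polynomial to be the `p`-th cyclotomic polynomial. Hence `M = S[ζ]`, with
`(0, 1)` acting as multiplication by some `β` which reduces to `1`, satisfies `β ^ p = 1`, and on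
which the Galois group acts through the inverse `χ⁻¹` of the cyclotomic character. The Galois group
acts on the `i`-th graded piece of the `π`-adic filtration through `χ ^ i`, which differs from
`χ⁻¹` for `0 < i < p - 2`, so `β = 1 + r π ^ (p - 2)` up to higher order terms, and `β ^ p = 1`
kills these terms and forces `p r = 0`. Lifts over `S` are therefore classified by the elements `r`
of the maximal ideal with `p r = 0`, a functor represented by `ℤ_p⟦t⟧ / (p t)`.
-/

lemma krullDim_fin_succ (n : ℕ) : Order.krullDim (Fin (n + 1)) = n := by
  refine le_antisymm (iSup_le fun s => ?_)
    (Order.LTSeries.length_le_krullDim (.mk n id strictMono_id))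
  have := s.length_lt_card
  rw [Fintype.card_fin] at this
  exact_mod_cast Nat.lt_succ_iff.1 this

lemma mem_smul_top_of_one_tmul_eq_zero {S k M : Type*} [CommRing S] [CommRing k] [Algebra S k]
    [AddCommGroup M] [Module S M] [Module.Free S M] {m : M} (h : (1 : k) ⊗ₜ[S] m = 0) :
    m ∈ (RingHom.ker (algebraMap S k) • ⊤ : Submodule S M) := by
  let b := Module.Free.chooseBasis S M
  rw [← b.linearCombination_repr m]
  refine Submodule.sum_mem _ fun i _ => Submodule.smul_mem_smul ?_ Submodule.mem_top
  simpa [Algebra.smul_def] using congrArg (fun x => (b.baseChange k).repr x i) h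

namespace IsCoefficientRing

variable (k : Type*) {S : Type*} [Field k] [CommRing S] [Algebra S k] [IsCoefficientRing k S]

lemma ker_algebraMap : RingHom.ker (algebraMap S k) = IsLocalRing.maximalIdeal S :=
  IsLocalRing.eq_maximalIdeal
    (RingHom.ker_isMaximal_of_surjective _ IsCoefficientRing.residue_surjective)

lemma mem_maximalIdeal {s : S} : s ∈ IsLocalRing.maximalIdeal S ↔ algebraMap S k s = 0 := by
  rw [← ker_algebraMap k, RingHom.mem_ker]

lemma isUnit_iff {s : S} : IsUnit s ↔ algebraMap S k s ≠ 0 := by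
  rw [Ne, ← mem_maximalIdeal, IsLocalRing.mem_maximalIdeal, mem_nonunits_iff, not_not]

variable {k} in
lemma surjective_of_residue {V M N : Type*} [AddCommGroup M] [Module S M] [Module.Free S M]
    [Module.Finite S M] [AddCommGroup V] [Module k V] [AddCommGroup N] [Module S N]
    (φ : k ⊗[S] M ≃ₗ[k] V) {f : N →ₗ[S] M} (hf : ∀ m, ∃ n, φ (1 ⊗ₜ f n) = φ (1 ⊗ₜ m)) :
    Function.Surjective f := by
  rw [← LinearMap.range_eq_top, ← top_le_iff]
  refine Submodule.le_of_le_smul_of_le_jacobson_bot (I := IsLocalRing.maximalIdeal S)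
    Module.Finite.fg_top (IsLocalRing.maximalIdeal_le_jacobson _) fun m _ => ?_
  obtain ⟨n, hn⟩ := hf m
  have sub_mem : m - f n ∈ IsLocalRing.maximalIdeal S • (⊤ : Submodule S M) := by
    rw [← ker_algebraMap k]
    apply mem_smul_top_of_one_tmul_eq_zero
    rw [TensorProduct.tmul_sub, φ.injective hn, sub_self]
  rw [← add_sub_cancel (f n) m]
  exact Submodule.add_mem_sup ⟨n, rfl⟩ sub_mem

end IsCoefficientRing

lemma DefLift.exists_fixed_lift {k S G H V : Type*} [Field k] [CommRing S] [Algebra S k]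
    [Group G] [Group H] [Fintype H] [AddCommGroup V] [Module k V] {ρ : Representation k G V}
    (L : DefLift ρ S) (hk : Function.Surjective (algebraMap S k)) (j : H →* G)
    (hcard : IsUnit (Fintype.card H : S)) {v : V} (hv : ∀ h, ρ (j h) v = v) :
    ∃ e : L.M, (∀ h, L.rep (j h) e = e) ∧ L.φ (1 ⊗ₜ e) = v := by
  obtain ⟨m, hm⟩ := TensorProduct.mk_surjective S L.M k hk (L.φ.symm v)
  have hm' : L.φ (1 ⊗ₜ m) = v := by
    rw [← LinearEquiv.eq_symm_apply, ← hm]; rfl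
  obtain ⟨w, hw⟩ := hcard
  refine ⟨(↑w⁻¹ : S) • ∑ h, L.rep (j h) m, fun h => ?_, ?_⟩
  · rw [map_smul, map_sum]
    congr 1
    conv_rhs => rw [← Equiv.sum_comp (Equiv.mulLeft h)]
    simp
  · rw [TensorProduct.tmul_smul, ← algebraMap_smul k, map_smul, TensorProduct.tmul_sum, map_sum]
    simp only [L.equivariant, hm', hv, Finset.sum_const, Finset.card_univ]
    rw [← Nat.cast_smul_eq_nsmul k, ← map_natCast (algebraMap S k), ← hw, smul_smul, ← map_mul,
      Units.inv_mul, map_one, one_smul]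

section Cyclotomic

open Polynomial

section ZModExponents

variable {M : Type*} {p : ℕ}

lemma pow_val_natCast [Monoid M] {w : M} (h : w ^ p = 1) (n : ℕ) :
    w ^ (n : ZMod p).val = w ^ n := by
  rw [ZMod.val_natCast, ← pow_eq_pow_mod n h]

lemma pow_val_add [Monoid M] [NeZero p] {w : M} (h : w ^ p = 1) (a b : ZMod p) :
    w ^ (a + b).val = w ^ a.val * w ^ b.val := by
  rw [← pow_add, ← pow_val_natCast h (a.val + b.val)]
  simp

lemma pow_val_mul [Monoid M] [NeZero p] {w : M} (h : w ^ p = 1) (a b : ZMod p) :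
    w ^ (a * b).val = (w ^ a.val) ^ b.val := by
  rw [← pow_mul, ← pow_val_natCast h (a.val * b.val)]
  simp

lemma sum_zmod_val [AddCommMonoid M] [NeZero p] (f : ℕ → M) :
    ∑ i : ZMod p, f i.val = ∑ i ∈ Finset.range p, f i :=
  Finset.sum_bij (fun i _ => i.val) (fun i _ => Finset.mem_range.2 i.val_lt)
    (fun _ _ _ _ h => ZMod.val_injective p h)
    (fun j hj => ⟨j, Finset.mem_univ _, ZMod.val_natCast_of_lt (Finset.mem_range.1 hj)⟩)
    (fun _ _ => rfl)

lemma geom_sum_pow_val [Semiring M] [NeZero p] {w : M} (h : w ^ p = 1) (a : (ZMod p)ˣ) :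
    ∑ i ∈ Finset.range p, (w ^ (a : ZMod p).val) ^ i = ∑ i ∈ Finset.range p, w ^ i := by
  simp_rw [← sum_zmod_val (p := p), ← pow_val_mul h]
  exact Equiv.sum_comp (Units.mulLeft a) fun i : ZMod p => w ^ i.val

lemma exists_units_zmod_val_eq_two [Fact p.Prime] (hp : 3 ≤ p) :
    ∃ a : (ZMod p)ˣ, (a : ZMod p).val = 2 := by
  have two_ne_zero : ((2 : ℕ) : ZMod p) ≠ 0 := fun h =>
    absurd (Nat.le_of_dvd two_pos ((ZMod.natCast_eq_zero_iff 2 p).1 h)) (by omega)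
  exact ⟨Units.mk0 _ two_ne_zero, ZMod.val_natCast_of_lt (by omega)⟩

lemma exists_units_zmod_pow_ne_one [Fact p.Prime] {i : ℕ} (h0 : 0 < i) (h1 : i < p - 1) :
    ∃ a : (ZMod p)ˣ, a ^ i ≠ 1 := by
  by_contra! h
  rw [FiniteField.forall_pow_eq_one_iff, ZMod.card] at h
  exact absurd (Nat.le_of_dvd h0 h) (by omega)

end ZModExponents

section CommRing

variable {B : Type*} [CommRing B] {p : ℕ}

lemma aeval_cyclotomic_prime [Fact p.Prime] (S : Type*) [CommRing S] {A : Type*} [Ring A]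
    [Algebra S A] (b : A) : aeval b (cyclotomic p S) = ∑ i ∈ Finset.range p, b ^ i := by
  simp [cyclotomic_prime]

lemma exists_one_add_pow_prime_eq (hp : p.Prime) (γ : B) :
    ∃ q : B, (1 + γ) ^ p = 1 + γ ^ p + p * γ * (1 + γ * q) := by
  have h1 : 1 ∈ Finset.Ioo 0 p := Finset.mem_Ioo.2 ⟨one_pos, hp.one_lt⟩
  obtain ⟨q, hq⟩ : γ ∣ ∑ k ∈ (Finset.Ioo 0 p).erase 1,
      γ ^ (k - 1) * 1 ^ (p - k - 1) * ↑(p.choose k / p) := by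
    refine Finset.dvd_sum fun k hk => ?_
    simp only [Finset.mem_erase, Finset.mem_Ioo] at hk
    exact dvd_mul_of_dvd_left (dvd_mul_of_dvd_left (dvd_pow_self γ (by omega)) _) _
  refine ⟨q, ?_⟩
  rw [add_comm 1 γ, add_pow_prime_eq hp, ← Finset.add_sum_erase _ _ h1, hq]
  simp [Nat.div_self hp.pos, add_comm]

lemma isUnit_intCast_of_mem_jacobson [Fact p.Prime] (hp : (p : B) ∈ Ideal.jacobson ⊥) {n : ℤ}
    (hn : (n : ZMod p) ≠ 0) : IsUnit (n : B) := by
  have coprime : IsCoprime (n : ℤ) p :=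
    ((Nat.prime_iff_prime_int.1 Fact.out).coprime_iff_not_dvd.2
      (mt (ZMod.intCast_zmod_eq_zero_iff_dvd n p).2 hn)).symm
  obtain ⟨a, b, hab⟩ := coprime
  have unit : IsUnit ((p : B) * -b + 1) := Ideal.mem_jacobson_bot.1 hp _
  have habB := congrArg (Int.cast : ℤ → B) hab
  push_cast at habB
  exact isUnit_of_mul_isUnit_right (x := (a : B)) (by convert unit using 1; linear_combination habB)

lemma isUnit_val_pow_sub_val_of_mem_jacobson [Fact p.Prime] (hp : (p : B) ∈ Ideal.jacobson ⊥)
    {a b : (ZMod p)ˣ} {i : ℕ} (h : a ^ i ≠ b) :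
    IsUnit (((a : ZMod p).val : B) ^ i - ((b : ZMod p).val : B)) := by
  have := isUnit_intCast_of_mem_jacobson hp
    (n := ((a : ZMod p).val : ℤ) ^ i - ((b : ZMod p).val : ℤ)) ?_
  · simpa using this
  · rw [Ne, Units.ext_iff, Units.val_pow_eq_pow_val] at h
    simpa [sub_eq_zero] using h

lemma map_le_jacobson_bot_of_isIntegral {S : Type*} [CommRing S] [Algebra S B]
    [Algebra.IsIntegral S B] {I : Ideal S} (hI : I ≤ Ideal.jacobson ⊥) :
    I.map (algebraMap S B) ≤ Ideal.jacobson ⊥ := by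
  rw [Ideal.map_le_iff_le_comap]
  intro s hs
  refine Ideal.mem_sInf.2 fun {P} hP => ?_
  have := hP.2
  exact Ideal.mem_sInf.1 (hI hs) ⟨bot_le, Ideal.isMaximal_comap_of_isIntegral_of_isMaximal P⟩

lemma apply_mem_of_mem_map {S : Type*} [CommRing S] [Algebra S B] (f : B →ₗ[S] S) {J : Ideal S}
    {b : B} (hb : b ∈ J.map (algebraMap S B)) : f b ∈ J := by
  have hb' : b ∈ (J • ⊤ : Submodule S B) := by rwa [Ideal.smul_top_eq_map]
  have := Submodule.mem_map_of_mem (f := f) hb'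
  rw [Submodule.map_smul''] at this
  exact (Ideal.mul_le_left : J * Submodule.map f ⊤ ≤ J) this

end CommRing

section CyclicVector

variable {S M : Type*} [CommRing S] [AddCommGroup M] [Module S M]

lemma det_eq_one_of_mul_eq_sq_mul {A X : Module.End S M} (hA : IsUnit A) (hX : IsUnit X)
    (h : A * X = X ^ 2 * A) : LinearMap.det X = 1 := by
  have hdetA : IsUnit (LinearMap.det A) := hA.map _
  have hdetX : IsUnit (LinearMap.det X) := hX.map _
  have hdet := congrArg LinearMap.det h
  simp only [map_mul, map_pow] at hdet
  rw [mul_comm, hdetA.mul_left_inj, sq] at hdet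
  exact hdetX.mul_left_cancel (by rw [mul_one, ← hdet])

lemma eq_cyclotomic_prime_of_monic {p : ℕ} [Fact p.Prime] [Nontrivial S] {f : S[X]} (hf : f.Monic)
    (natDegree_eq : f.natDegree = p - 1) (coeff_zero : f.coeff 0 = 1) (dvd : f ∣ X ^ p - 1) :
    f = cyclotomic p S := by
  have hp : p ≠ 0 := (Fact.out : p.Prime).ne_zero
  obtain ⟨g, hg⟩ := dvd
  have monic_prod : (X ^ p - 1 : S[X]).Monic := by simpa using monic_X_pow_sub_C (1 : S) hp
  have hg_monic : g.Monic := hf.of_mul_monic_left (hg ▸ monic_prod)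
  have hg_natDegree : g.natDegree = 1 := by
    have := congrArg natDegree hg
    rw [hf.natDegree_mul hg_monic, ← C_1, natDegree_X_pow_sub_C, natDegree_eq] at this
    omega
  have hg_coeff : g.coeff 0 = -1 := by
    simpa [mul_coeff_zero, coeff_zero, hp, hp.symm, eq_comm] using congrArg (coeff · 0) hg
  have hg_eq : g = X - 1 := by
    rw [hg_monic.eq_X_add_C hg_natDegree, hg_coeff, C_neg, C_1, sub_eq_add_neg]
  have X_sub_one_monic : (X - 1 : S[X]).Monic := by simpa using monic_X_sub_C (1 : S)
  apply X_sub_one_monic.isRegular.right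
  simp only
  rw [cyclotomic_prime_mul_X_sub_one, hg, hg_eq]

variable [Nontrivial S] [Module.Free S M] [Module.Finite S M] {X : Module.End S M} {e : M}

lemma charpoly_dvd_iff_aeval_apply_eq_zero (he : Function.Surjective fun f : S[X] => aeval X f e)
    {f : S[X]} : X.charpoly ∣ f ↔ aeval X f e = 0 := by
  refine ⟨fun ⟨g, hg⟩ => by simp [hg, LinearMap.aeval_self_charpoly], fun hf => ?_⟩
  let apply : S[X] →ₗ[S] M := (LinearMap.applyₗ e).comp (aeval X).toLinearMap
  let applyLT := apply.domRestrict (degreeLT S (Module.finrank S M))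
  have mod_mem (g : S[X]) : g %ₘ X.charpoly ∈ degreeLT S (Module.finrank S M) := by
    rw [mem_degreeLT, ← X.charpoly_natDegree, ← degree_eq_natDegree X.charpoly_monic.ne_zero]
    exact degree_modByMonic_lt g X.charpoly_monic
  have surjective : Function.Surjective applyLT := fun m => by
    obtain ⟨g, rfl⟩ := he m
    exact ⟨⟨_, mod_mem g⟩, by simp [applyLT, apply, ← LinearMap.aeval_eq_aeval_mod_charpoly]⟩
  have injective : Function.Injective applyLT :=
    OrzechProperty.injective_of_surjective_of_injective
      ((degreeLTEquiv S _).trans (Module.finBasis S M).equivFun.symm).toLinearMap applyLT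
      (LinearEquiv.injective _) surjective
  rw [← modByMonic_eq_zero_iff_dvd X.charpoly_monic]
  have := @injective ⟨_, mod_mem f⟩ 0
    (by simpa [applyLT, apply, ← LinearMap.aeval_eq_aeval_mod_charpoly] using hf)
  exact congrArg Subtype.val this

lemma charpoly_eq_cyclotomic_prime {p : ℕ} [Fact p.Prime] (hp : p ≠ 2)
    (hrank : Module.finrank S M = p - 1) (he : Function.Surjective fun f : S[X] => aeval X f e)
    (hX : X ^ p = 1) {A : Module.End S M} (hA : IsUnit A) (hAX : A * X = X ^ 2 * A) :
    X.charpoly = cyclotomic p S := by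
  have hp_prime : p.Prime := Fact.out
  refine eq_cyclotomic_prime_of_monic X.charpoly_monic (by rw [X.charpoly_natDegree, hrank]) ?_
    ((charpoly_dvd_iff_aeval_apply_eq_zero he).2 (by simp [hX]))
  have hdet := det_eq_one_of_mul_eq_sq_mul hA (.of_pow_eq_one hX hp_prime.ne_zero) hAX
  rwa [LinearMap.det_eq_sign_charpoly_coeff, hrank,
    (hp_prime.even_sub_one hp).neg_one_pow, one_mul] at hdet

end CyclicVector

namespace DiagGroup

variable (p : ℕ)

/-- The element `((1, 0), 1)`. -/
def x : DiagGroup p := SemidirectProduct.inl (Multiplicative.ofAdd (1, 0))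

/-- The element `((0, 1), 1)`. -/
def y : DiagGroup p := SemidirectProduct.inl (Multiplicative.ofAdd (0, 1))

variable {p}

lemma x_pow (n : ℕ) :
    x p ^ n = SemidirectProduct.inl (Multiplicative.ofAdd ((n : ZMod p), 0)) := by
  rw [x, ← map_pow, ← ofAdd_nsmul]
  simp

lemma y_pow (n : ℕ) :
    y p ^ n = SemidirectProduct.inl (Multiplicative.ofAdd (0, (n : ZMod p))) := by
  rw [y, ← map_pow, ← ofAdd_nsmul]
  simp

lemma x_pow_self : x p ^ p = 1 := by
  rw [x_pow, ZMod.natCast_self]; rfl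

lemma y_pow_self : y p ^ p = 1 := by
  rw [y_pow, ZMod.natCast_self]; rfl

lemma x_mul_y : x p * y p = y p * x p := by
  rw [x, y, ← map_mul SemidirectProduct.inl, ← map_mul SemidirectProduct.inl, mul_comm]

lemma inr_mul_inl (a : (ZMod p)ˣ) (v : ZMod p × ZMod p) :
    (SemidirectProduct.inr a * SemidirectProduct.inl (Multiplicative.ofAdd v) : DiagGroup p) =
      SemidirectProduct.inl (Multiplicative.ofAdd ((a : ZMod p) * v.1, (↑a⁻¹ : ZMod p) * v.2)) *
        SemidirectProduct.inr a := by
  have := SemidirectProduct.inl_aut (φ := diagAction p) a (Multiplicative.ofAdd v)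
  rw [map_inv, eq_mul_inv_iff_mul_eq] at this
  exact this.symm

variable [NeZero p]

lemma inr_mul_x (a : (ZMod p)ˣ) : (SemidirectProduct.inr a : DiagGroup p) * x p =
    x p ^ (a : ZMod p).val * SemidirectProduct.inr a := by
  rw [x_pow]
  simpa [x] using inr_mul_inl a (1, 0)

lemma inr_mul_y (a : (ZMod p)ˣ) : (SemidirectProduct.inr a : DiagGroup p) * y p =
    y p ^ (↑a⁻¹ : ZMod p).val * SemidirectProduct.inr a := by
  rw [y_pow]
  simpa [y] using inr_mul_inl a (0, 1)

lemma eq_mul (g : DiagGroup p) : g = x p ^ (Multiplicative.toAdd g.left).1.val *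
    y p ^ (Multiplicative.toAdd g.left).2.val * SemidirectProduct.inr g.right := by
  rw [x_pow, y_pow, ← map_mul, ZMod.natCast_zmod_val, ZMod.natCast_zmod_val, ← ofAdd_add]
  conv_lhs => rw [← SemidirectProduct.inl_left_mul_inr_right g]
  congr 2
  apply Multiplicative.toAdd.injective
  simp

end DiagGroup

/-- The ring `S[ζ]` obtained from `S` by adjoining a primitive `p`-th root of unity `ζ`. It carries
both the universal lift and, for `S = 𝔽_p`, the module `V` itself. -/
abbrev AdjoinZeta (p : ℕ) (S : Type*) [CommRing S] : Type _ := AdjoinRoot (cyclotomic p S)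

namespace AdjoinZeta

section Basic

variable (p : ℕ) (S : Type*) [CommRing S]

/-- The adjoined root of unity `ζ`. -/
noncomputable abbrev zeta : AdjoinZeta p S := AdjoinRoot.root (cyclotomic p S)

/-- The element `π = ζ - 1`, which serves as a uniformizer. -/
noncomputable def zetaSubOne : AdjoinZeta p S := zeta p S - 1

local notation "π" => zetaSubOne p S

variable [Fact p.Prime]

lemma geom_sum_zeta : ∑ i ∈ Finset.range p, zeta p S ^ i = 0 := by
  rw [← aeval_cyclotomic_prime S, AdjoinRoot.aeval_eq, AdjoinRoot.mk_self]

lemma zeta_pow : zeta p S ^ p = 1 := by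
  have := geom_sum_mul (zeta p S) p
  rw [geom_sum_zeta, zero_mul] at this
  exact sub_eq_zero.1 this.symm

lemma cyclotomic_zmod_eq : cyclotomic p (ZMod p) = (X - 1) ^ (p - 1) := by
  have X_sub_one_ne_zero : (X - 1 : (ZMod p)[X]) ≠ 0 := by
    simpa using X_sub_C_ne_zero (1 : ZMod p)
  refine mul_right_cancel₀ X_sub_one_ne_zero ?_
  rw [cyclotomic_prime_mul_X_sub_one, ← pow_succ,
    Nat.sub_add_cancel (Fact.out : p.Prime).one_le, sub_pow_char, one_pow]

lemma natCast_dvd_zetaSubOne_pow : (p : AdjoinZeta p S) ∣ π ^ (p - 1) := by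
  obtain ⟨g, hg⟩ : C (p : ℤ) ∣ (X - 1) ^ (p - 1) - cyclotomic p ℤ := by
    refine (C_dvd_iff_dvd_coeff _ _).2 fun i => ?_
    rw [← ZMod.intCast_zmod_eq_zero_iff_dvd, ← eq_intCast (Int.castRingHom (ZMod p)), ← coeff_map]
    simp [cyclotomic_zmod_eq]
  have := congrArg (aeval (zeta p S)) hg
  rw [map_sub, aeval_cyclotomic_prime ℤ, geom_sum_zeta] at this
  exact ⟨aeval (zeta p S) g, by simpa [zetaSubOne] using this⟩

variable [Nontrivial S]

lemma natDegree_cyclotomic_prime : (cyclotomic p S).natDegree = p - 1 := by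
  rw [natDegree_cyclotomic, Nat.totient_prime Fact.out]

/-- The basis `1, ζ, …, ζ ^ (p - 2)` of `S[ζ]`. -/
noncomputable def basis : Module.Basis (Fin (p - 1)) S (AdjoinZeta p S) :=
  (AdjoinRoot.powerBasis' (cyclotomic.monic p S)).basis.reindex
    (finCongr (by simpa using natDegree_cyclotomic_prime p S))

@[simp] lemma basis_apply (i : Fin (p - 1)) : basis p S i = zeta p S ^ (i : ℕ) := by
  simp [basis]

instance : Module.Free S (AdjoinZeta p S) := .of_basis (basis p S)

instance : Module.Finite S (AdjoinZeta p S) := .of_basis (basis p S)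

lemma finrank_eq : Module.finrank S (AdjoinZeta p S) = p - 1 := by
  simp [Module.finrank_eq_card_basis (basis p S)]

/-- The coordinate of `ζ ^ (p - 2)`, which detects multiples of `π ^ (p - 2)`. -/
noncomputable def topCoeff : AdjoinZeta p S →ₗ[S] S :=
  (lcoeff S (p - 2)).comp (AdjoinRoot.modByMonicHom (cyclotomic.monic p S))

lemma topCoeff_zetaSubOne_pow : topCoeff p S (π ^ (p - 2)) = 1 := by
  have hp : 2 ≤ p := (Fact.out : p.Prime).two_le
  have monic : ((X - C 1 : S[X]) ^ (p - 2)).Monic := (monic_X_sub_C 1).pow _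
  have natDegree_eq : ((X - C 1 : S[X]) ^ (p - 2)).natDegree = p - 2 := by
    rw [(monic_X_sub_C 1).natDegree_pow, natDegree_X_sub_C, mul_one]
  have degree_lt : ((X - C 1 : S[X]) ^ (p - 2)).degree < (cyclotomic p S).degree := by
    rw [degree_eq_natDegree monic.ne_zero, degree_eq_natDegree (cyclotomic.monic p S).ne_zero,
      natDegree_eq, natDegree_cyclotomic_prime]
    exact_mod_cast (by omega : p - 2 < p - 1)
  have mk_eq : π ^ (p - 2) = AdjoinRoot.mk (cyclotomic p S) ((X - C 1) ^ (p - 2)) := by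
    simp [zetaSubOne]
  rw [topCoeff, LinearMap.comp_apply, mk_eq, AdjoinRoot.modByMonicHom_mk,
    (modByMonic_eq_self_iff (cyclotomic.monic p S)).2 degree_lt, lcoeff_apply]
  have coeff_eq_one := monic.coeff_natDegree
  rwa [natDegree_eq] at coeff_eq_one

lemma smul_zetaSubOne_pow_injective :
    Function.Injective fun r : S => r • π ^ (p - 2) := fun r s h => by
  simpa [topCoeff_zetaSubOne_pow] using congrArg (topCoeff p S) h

end Basic

section Galois

variable (p : ℕ) (S : Type*) [CommRing S]

local notation "π" => zetaSubOne p S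

lemma zetaSubOne_dvd_zeta_pow_sub_one (n : ℕ) : π ∣ zeta p S ^ n - 1 := by
  simpa [zetaSubOne] using sub_dvd_pow_sub_pow (zeta p S) 1 n

variable [Fact p.Prime]

/-- The Galois action of `(ℤ/p)ˣ` on `S[ζ]`, in which `a` maps `ζ` to `ζ ^ a`. -/
noncomputable def galois : (ZMod p)ˣ →* (AdjoinZeta p S →ₐ[S] AdjoinZeta p S) where
  toFun a := AdjoinRoot.liftAlgHom (cyclotomic p S) (Algebra.ofId S _)
    (zeta p S ^ (a : ZMod p).val) (by
      change aeval (zeta p S ^ (a : ZMod p).val) (cyclotomic p S) = 0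
      rw [aeval_cyclotomic_prime, geom_sum_pow_val (zeta_pow p S), geom_sum_zeta])
  map_one' := AdjoinRoot.algHom_ext (by
    have : Fact (1 < p) := ⟨(Fact.out : p.Prime).one_lt⟩
    simp [ZMod.val_one])
  map_mul' a b := AdjoinRoot.algHom_ext (by simp [pow_val_mul (zeta_pow p S)])

@[simp] lemma galois_zeta (a : (ZMod p)ˣ) :
    galois p S a (zeta p S) = zeta p S ^ (a : ZMod p).val := by
  simp [galois]

lemma exists_galois_zetaSubOne_eq (a : (ZMod p)ˣ) :
    ∃ u, galois p S a π = π * u ∧ π ∣ u - ((a : ZMod p).val : AdjoinZeta p S) := by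
  refine ⟨∑ i ∈ Finset.range (a : ZMod p).val, zeta p S ^ i, ?_, ?_⟩
  · rw [zetaSubOne, mul_comm, geom_sum_mul]
    simp
  · simpa using Finset.dvd_sum fun i (_ : i ∈ Finset.range (a : ZMod p).val) =>
      zetaSubOne_dvd_zeta_pow_sub_one p S i

lemma zetaSubOne_pow_succ_dvd_galois_sub (a : (ZMod p)ˣ) (i : ℕ) :
    π ^ (i + 1) ∣ galois p S a (π ^ i) - ((a : ZMod p).val : S) ^ i • π ^ i := by
  obtain ⟨u, hu, hua⟩ := exists_galois_zetaSubOne_eq p S a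
  rw [map_pow, hu, mul_pow, Algebra.smul_def, map_pow, map_natCast, mul_comm (_ ^ i) (π ^ i),
    ← mul_sub, pow_succ]
  exact mul_dvd_mul_left _ (hua.trans (sub_dvd_pow_sub_pow _ _ i))

variable {p S}

lemma zetaSubOne_dvd_galois_sub (a : (ZMod p)ˣ) (b : AdjoinZeta p S) :
    π ∣ galois p S a b - b := by
  obtain ⟨f, rfl⟩ := AdjoinRoot.mk_surjective b
  rw [← AdjoinRoot.aeval_eq, ← aeval_algHom_apply, galois_zeta, aeval_def, aeval_def, ← eval_map,
    ← eval_map]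
  refine dvd_trans ?_ (sub_dvd_eval_sub _ _ _)
  simpa [zetaSubOne] using
    dvd_sub (zetaSubOne_dvd_zeta_pow_sub_one p S (a : ZMod p).val) (dvd_refl π)

end Galois

section Filtration

variable {p : ℕ} {S : Type*} [CommRing S]

local notation "π" => zetaSubOne p S

/-- The `i`-th step `π ^ i J[ζ]` of the `π`-adic filtration of `J[ζ]`, for an ideal `J` of `S`. On
its `i`-th graded piece the Galois group acts through the `i`-th power of the cyclotomic
character. -/
noncomputable def filtration (J : Ideal S) (i : ℕ) : Ideal (AdjoinZeta p S) :=
  Ideal.span {π ^ i} * J.map (algebraMap S (AdjoinZeta p S))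

variable {J : Ideal S} {i : ℕ} {b : AdjoinZeta p S}

lemma mem_filtration_iff :
    b ∈ filtration J i ↔ ∃ κ ∈ J.map (algebraMap S (AdjoinZeta p S)), π ^ i * κ = b :=
  Ideal.mem_span_singleton_mul

lemma mem_filtration_zero_iff :
    b ∈ filtration J 0 ↔ b ∈ J.map (algebraMap S (AdjoinZeta p S)) := by
  simp [mem_filtration_iff]

lemma mem_filtration_top_iff : b ∈ filtration (⊤ : Ideal S) i ↔ π ^ i ∣ b := by
  simp [mem_filtration_iff, Ideal.map_top, dvd_def, eq_comm]

lemma pow_mul_mem_filtration {j : ℕ} (hb : b ∈ filtration J i) :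
    π ^ j * b ∈ filtration J (i + j) := by
  obtain ⟨κ, hκ, rfl⟩ := mem_filtration_iff.1 hb
  exact mem_filtration_iff.2 ⟨κ, hκ, by ring⟩

lemma mul_mem_filtration_of_dvd {c : AdjoinZeta p S} {j : ℕ} (hc : π ^ j ∣ c)
    (hb : b ∈ filtration J i) : c * b ∈ filtration J (i + j) := by
  obtain ⟨d, rfl⟩ := hc
  rw [mul_comm (π ^ j), mul_assoc]
  exact Ideal.mul_mem_left _ d (pow_mul_mem_filtration hb)

lemma filtration_antitone (J : Ideal S) : Antitone (filtration (p := p) J) :=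
  antitone_nat_of_succ_le fun i => Ideal.mul_mono_left (by
    rw [Ideal.span_singleton_le_span_singleton]
    exact pow_dvd_pow _ i.le_succ)

lemma smul_mem_filtration {s : S} (hs : s ∈ J) (b : AdjoinZeta p S) :
    s • b ∈ filtration J 0 := by
  rw [mem_filtration_zero_iff, Algebra.smul_def]
  exact Ideal.mul_mem_right _ _ (Ideal.mem_map_of_mem _ hs)

@[elab_as_elim]
lemma filtration_zero_induction {P : AdjoinZeta p S → Prop} (hb : b ∈ filtration J 0)
    (smul : ∀ s ∈ J, ∀ b, P (s • b)) (add : ∀ b c, P b → P c → P (b + c)) : P b := by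
  have hb' : b ∈ (J • ⊤ : Submodule S (AdjoinZeta p S)) := by
    rw [Ideal.smul_top_eq_map]
    exact mem_filtration_zero_iff.1 hb
  exact Submodule.smul_induction_on hb' (fun s hs b _ => smul s hs b) add

lemma exists_zetaSubOne_dvd_sub_smul_one (b : AdjoinZeta p S) : ∃ c : S, π ∣ b - c • 1 := by
  obtain ⟨f, rfl⟩ := AdjoinRoot.mk_surjective b
  have eval_one : aeval (1 : AdjoinZeta p S) f = f.eval 1 • 1 := by
    rw [← map_one (algebraMap S _), aeval_algebraMap_apply, Algebra.algebraMap_eq_smul_one,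
      map_one, coe_aeval_eq_eval]
  refine ⟨f.eval 1, ?_⟩
  rw [← eval_one, ← AdjoinRoot.aeval_eq, aeval_def, aeval_def, ← eval_map, ← eval_map]
  exact sub_dvd_eval_sub _ _ _

lemma exists_sub_smul_pow_mem_filtration (hb : b ∈ filtration J i) :
    ∃ c ∈ J, b - c • π ^ i ∈ filtration J (i + 1) := by
  obtain ⟨κ, hκ, rfl⟩ := mem_filtration_iff.1 hb
  suffices h : ∃ c ∈ J, κ - c • 1 ∈ filtration J 1 by
    obtain ⟨c, hc, hκc⟩ := h
    refine ⟨c, hc, ?_⟩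
    have := pow_mul_mem_filtration (j := i) hκc
    rwa [mul_sub, mul_smul_comm, mul_one, add_comm] at this
  refine filtration_zero_induction (mem_filtration_zero_iff.2 hκ) (fun s hs d => ?_) ?_
  · obtain ⟨c, hc⟩ := exists_zetaSubOne_dvd_sub_smul_one d
    obtain ⟨d', hd'⟩ := hc
    refine ⟨s * c, Ideal.mul_mem_right _ _ hs, ?_⟩
    rw [mul_smul, ← smul_sub, hd', ← mul_smul_comm, ← pow_one π]
    simpa using pow_mul_mem_filtration (j := 1) (smul_mem_filtration hs d')
  · rintro d d' ⟨c, hc, hd⟩ ⟨c', hc', hd'⟩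
    exact ⟨c + c', add_mem hc hc', by convert add_mem hd hd' using 1; rw [add_smul]; ring⟩

variable [Fact p.Prime]

lemma galois_sub_self_mem_filtration (a : (ZMod p)ˣ) (hb : b ∈ filtration J 0) :
    galois p S a b - b ∈ filtration J 1 := by
  refine filtration_zero_induction hb (fun s hs b => ?_) fun b c hb hc => ?_
  · obtain ⟨d, hd⟩ := zetaSubOne_dvd_galois_sub a b
    rw [map_smul, ← smul_sub, hd, ← mul_smul_comm]
    simpa using pow_mul_mem_filtration (j := 1) (smul_mem_filtration hs d)
  · rw [map_add, add_sub_add_comm]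
    exact add_mem hb hc

lemma galois_sub_pow_smul_mem_filtration (a : (ZMod p)ˣ) (hb : b ∈ filtration J i) :
    galois p S a b - ((a : ZMod p).val : S) ^ i • b ∈ filtration J (i + 1) := by
  obtain ⟨κ, hκ, rfl⟩ := mem_filtration_iff.1 hb
  rw [← mem_filtration_zero_iff] at hκ
  have hκ_sub := galois_sub_self_mem_filtration a hκ
  have hκ_map : galois p S a κ ∈ filtration J 0 := by
    simpa using add_mem (filtration_antitone J zero_le_one hκ_sub) hκ
  have leading := mul_mem_filtration_of_dvd (zetaSubOne_pow_succ_dvd_galois_sub p S a i) hκ_map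
  have trailing := Ideal.mul_mem_left _ (algebraMap S _ (((a : ZMod p).val : S) ^ i))
    (pow_mul_mem_filtration (j := i) hκ_sub)
  rw [zero_add] at leading
  rw [add_comm 1 i] at trailing
  convert add_mem leading trailing using 1
  rw [map_mul, Algebra.smul_def, Algebra.smul_def]
  ring

lemma mem_filtration_succ_of_galois_sub_smul_mem (a : (ZMod p)ˣ) {u : S}
    (hu : IsUnit (((a : ZMod p).val : S) ^ i - u)) (hb : b ∈ filtration J i)
    (hub : galois p S a b - u • b ∈ filtration J (i + 1)) : b ∈ filtration J (i + 1) := by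
  have smul_mem : (((a : ZMod p).val : S) ^ i - u) • b ∈ filtration J (i + 1) := by
    convert sub_mem hub (galois_sub_pow_smul_mem_filtration a hb) using 1
    rw [sub_smul, sub_sub_sub_cancel_left]
  exact ((filtration J (i + 1)).restrictScalars S).smul_mem_iff_of_isUnit hu |>.1 smul_mem

end Filtration

section RootOfUnity

variable {p : ℕ} {S : Type*} [CommRing S] {J : Ideal S} {i : ℕ}
  {β : AdjoinZeta p S}

local notation "π" => zetaSubOne p S

lemma pow_sub_one_sub_smul_mem_filtration (hi : 0 < i) (hβJ : β - 1 ∈ filtration J i) (n : ℕ) :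
    β ^ n - 1 - (n : S) • (β - 1) ∈ filtration J (i + 1) := by
  obtain ⟨k, hk⟩ := powAddExpansion 1 (β - 1) n
  obtain ⟨κ, -, hκ⟩ := mem_filtration_iff.1 hβJ
  have sq_mem : (β - 1) * (β - 1) ∈ filtration J (i + 1) :=
    filtration_antitone J (by omega) (mul_mem_filtration_of_dvd ⟨κ, hκ.symm⟩ hβJ)
  convert Ideal.mul_mem_left _ k sq_mem using 1
  rw [add_sub_cancel, one_pow, one_pow] at hk
  rw [Algebra.smul_def, map_natCast, hk]
  ring

lemma natCast_mul_eq_zero_of_mem_filtration_torsionOf {b : AdjoinZeta p S}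
    (hb : b ∈ filtration (Ideal.torsionOf S S (p : S)) 0) : (p : AdjoinZeta p S) * b = 0 := by
  refine filtration_zero_induction hb (fun s hs b => ?_) fun b c hb hc => ?_
  · rw [Ideal.mem_torsionOf_iff, smul_eq_mul] at hs
    rw [Algebra.smul_def, ← mul_assoc, ← map_natCast (algebraMap S (AdjoinZeta p S)), ← map_mul,
      mul_comm (p : S), hs, map_zero, zero_mul]
  · rw [mul_add, hb, hc, add_zero]

variable [Fact p.Prime]

lemma sub_one_mem_filtration_one (hp : 3 ≤ p) (hpow : β ^ p = 1)
    (hgal : ∀ a : (ZMod p)ˣ, galois p S a β = β ^ (↑a⁻¹ : ZMod p).val)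
    (hβJ : β - 1 ∈ filtration J 0) : β - 1 ∈ filtration J 1 := by
  -- In degree `0` the linearization of `β ^ n - 1` fails; use `β ^ 2 - β = β (β - 1)` instead.
  obtain ⟨a, ha⟩ := exists_units_zmod_val_eq_two hp
  have galois_sub := galois_sub_self_mem_filtration a⁻¹ hβJ
  rw [map_sub, map_one, hgal, inv_inv, ha] at galois_sub
  have hinv : β * β ^ (p - 1) = 1 := by
    rw [← pow_succ', Nat.sub_add_cancel (by omega), hpow]
  convert Ideal.mul_mem_left _ (β ^ (p - 1)) galois_sub using 1
  linear_combination (1 - β) * hinv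

lemma sub_one_mem_filtration_succ (hpS : (p : S) ∈ Ideal.jacobson ⊥)
    (hgal : ∀ a : (ZMod p)ˣ, galois p S a β = β ^ (↑a⁻¹ : ZMod p).val)
    (h0 : 0 < i) (hi : i < p - 2) (hβJ : β - 1 ∈ filtration J i) :
    β - 1 ∈ filtration J (i + 1) := by
  obtain ⟨a, ha⟩ := exists_units_zmod_pow_ne_one (p := p) (i := i + 1) (by omega) (by omega)
  have ha' : a ^ i ≠ a⁻¹ := by rwa [Ne, eq_inv_iff_mul_eq_one, ← pow_succ]
  refine mem_filtration_succ_of_galois_sub_smul_mem a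
    (isUnit_val_pow_sub_val_of_mem_jacobson hpS ha') hβJ ?_
  rw [map_sub, map_one, hgal]
  exact pow_sub_one_sub_smul_mem_filtration h0 hβJ _

lemma sub_one_mem_filtration (hp : 3 ≤ p) (hpS : (p : S) ∈ Ideal.jacobson ⊥) (hpow : β ^ p = 1)
    (hgal : ∀ a : (ZMod p)ˣ, galois p S a β = β ^ (↑a⁻¹ : ZMod p).val)
    (hβJ : β - 1 ∈ filtration J 0) (hi : i ≤ p - 2) : β - 1 ∈ filtration J i := by
  induction i with
  | zero => exact hβJ
  | succ i ih =>
    rcases Nat.eq_zero_or_pos i with rfl | h0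
    · exact sub_one_mem_filtration_one hp hpow hgal hβJ
    · exact sub_one_mem_filtration_succ hpS hgal h0 (by omega) (ih (by omega))

lemma eq_zero_of_mem_filtration_torsionOf {b : AdjoinZeta p S}
    (hb : b ∈ filtration (Ideal.torsionOf S S (p : S)) (p - 1)) : b = 0 := by
  obtain ⟨κ, hκ, rfl⟩ := mem_filtration_iff.1 hb
  obtain ⟨g, hg⟩ := natCast_dvd_zetaSubOne_pow p S
  rw [hg, mul_right_comm,
    natCast_mul_eq_zero_of_mem_filtration_torsionOf (mem_filtration_zero_iff.2 hκ), zero_mul]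

variable [Nontrivial S]

lemma natCast_mul_sub_one_eq_zero (hp : 3 ≤ p) (hJ : J ≤ Ideal.jacobson ⊥) (hpow : β ^ p = 1)
    (hβJ : β - 1 ∈ filtration J (p - 2)) : (p : AdjoinZeta p S) * (β - 1) = 0 := by
  obtain ⟨κ, hκ, hβκ⟩ := mem_filtration_iff.1 hβJ
  obtain ⟨q, hq⟩ := exists_one_add_pow_prime_eq (Fact.out : p.Prime) (β - 1)
  obtain ⟨y, hy⟩ : (p : AdjoinZeta p S) * κ ∣ (β - 1) ^ (p - 1) := by
    rw [← hβκ, mul_pow, ← pow_mul]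
    exact mul_dvd_mul ((natCast_dvd_zetaSubOne_pow p S).trans
      (pow_dvd_pow _ (Nat.le_mul_of_pos_left _ (by omega)))) (dvd_pow_self κ (by omega))
  have := Algebra.IsIntegral.of_finite S (AdjoinZeta p S)
  have isUnit_factor : IsUnit (κ * (y + π ^ (p - 2) * q) + 1) :=
    Ideal.mem_jacobson_bot.1 (map_le_jacobson_bot_of_isIntegral hJ hκ) _
  have pow_eq : (β - 1) ^ p = (β - 1) ^ (p - 1) * (β - 1) := by
    rw [← pow_succ, Nat.sub_add_cancel (by omega)]
  rw [add_sub_cancel, hpow, pow_eq, hy] at hq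
  rw [← isUnit_factor.mul_left_inj, zero_mul]
  linear_combination -hq + p * (β - 1) * q * hβκ

lemma mem_filtration_torsionOf_of_natCast_mul_eq_zero {b : AdjoinZeta p S}
    (hb : (p : AdjoinZeta p S) * b = 0) : b ∈ filtration (Ideal.torsionOf S S (p : S)) 0 := by
  rw [← (basis p S).sum_repr b]
  refine Ideal.sum_mem _ fun i _ => smul_mem_filtration ?_ _
  have hb' : (p : S) • b = 0 := by rw [Algebra.smul_def, map_natCast, hb]
  simpa [Ideal.mem_torsionOf_iff, mul_comm] using congrArg (fun b => (basis p S).repr b i) hb'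

theorem exists_eq_one_add_smul_zetaSubOne_pow (hp : 3 ≤ p) {I : Ideal S}
    (hI : I ≤ Ideal.jacobson ⊥) (hpI : (p : S) ∈ I) (hpow : β ^ p = 1)
    (hgal : ∀ a : (ZMod p)ˣ, galois p S a β = β ^ (↑a⁻¹ : ZMod p).val)
    (hβI : β - 1 ∈ I.map (algebraMap S (AdjoinZeta p S))) :
    ∃ r ∈ I, (p : S) * r = 0 ∧ β = 1 + r • π ^ (p - 2) := by
  have leading_order {J : Ideal S} (hβJ : β - 1 ∈ filtration J 0) :
      β - 1 ∈ filtration J (p - 2) :=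
    sub_one_mem_filtration hp (hI hpI) hpow hgal hβJ le_rfl
  have torsion : (p : AdjoinZeta p S) * (β - 1) = 0 :=
    natCast_mul_sub_one_eq_zero hp hI hpow (leading_order (mem_filtration_zero_iff.2 hβI))
  obtain ⟨r, hr, hβr⟩ := exists_sub_smul_pow_mem_filtration
    (leading_order (mem_filtration_torsionOf_of_natCast_mul_eq_zero torsion))
  rw [show p - 2 + 1 = p - 1 by omega] at hβr
  have sub_one_eq := sub_eq_zero.1 (eq_zero_of_mem_filtration_torsionOf hβr)
  refine ⟨r, ?_, ?_, by rw [← sub_one_eq]; ring⟩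
  · simpa [sub_one_eq, topCoeff_zetaSubOne_pow] using apply_mem_of_mem_map (topCoeff p S) hβI
  · rwa [Ideal.mem_torsionOf_iff, smul_eq_mul, mul_comm] at hr

end RootOfUnity

section StandardRepresentation

variable {p : ℕ} {S : Type*} [CommRing S]

local notation "π" => zetaSubOne p S

/-- The element `1 + r (ζ - 1) ^ (p - 2)`. When `p r = 0` it is a `p`-th root of unity on which the
Galois group acts through the inverse of the cyclotomic character. -/
noncomputable def socleUnit (p : ℕ) (r : S) : AdjoinZeta p S := 1 + r • zetaSubOne p S ^ (p - 2)

variable [Fact p.Prime]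

lemma smul_zetaSubOne_pow_eq_zero {r : S} (hr : (p : S) * r = 0) {n : ℕ} (hn : p - 1 ≤ n) :
    r • π ^ n = 0 := by
  obtain ⟨g, hg⟩ := (natCast_dvd_zetaSubOne_pow p S).trans (pow_dvd_pow π hn)
  rw [hg, ← map_natCast (algebraMap S (AdjoinZeta p S)), ← Algebra.smul_def, smul_smul, mul_comm,
    hr, zero_smul]

lemma socleUnit_pow (hp : 3 ≤ p) {r : S} (hr : (p : S) * r = 0) (n : ℕ) :
    socleUnit p r ^ n = 1 + (n * r) • π ^ (p - 2) := by
  have sq_eq_zero : (r • π ^ (p - 2)) * (r • π ^ (p - 2)) = 0 := by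
    rw [mul_smul_comm, smul_mul_assoc, ← pow_add, smul_zetaSubOne_pow_eq_zero hr (by omega),
      smul_zero]
  induction n with
  | zero => simp
  | succ n ih =>
    rw [pow_succ, ih, socleUnit, mul_smul]
    simp only [Algebra.smul_def, map_mul, map_natCast, Nat.cast_succ, map_add, map_one]
      at sq_eq_zero ⊢
    linear_combination (n : AdjoinZeta p S) * sq_eq_zero

lemma socleUnit_pow_prime (hp : 3 ≤ p) {r : S} (hr : (p : S) * r = 0) :
    socleUnit p r ^ p = 1 := by
  rw [socleUnit_pow hp hr, hr, zero_smul, add_zero]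

lemma galois_socleUnit (hp : 3 ≤ p) {r : S} (hr : (p : S) * r = 0) (a : (ZMod p)ˣ) :
    galois p S a (socleUnit p r) = socleUnit p r ^ (↑a⁻¹ : ZMod p).val := by
  have inv_eq : (↑a⁻¹ : ZMod p) = ((a : ZMod p).val ^ (p - 2) : ℕ) := by
    have : a⁻¹ = a ^ (p - 2) := by
      rw [inv_eq_iff_mul_eq_one, ← pow_succ', show p - 2 + 1 = p - 1 by omega,
        ZMod.units_pow_card_sub_one_eq_one]
    rw [this, Nat.cast_pow, ZMod.natCast_zmod_val, Units.val_pow_eq_pow_val]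
  obtain ⟨c, hc⟩ := zetaSubOne_pow_succ_dvd_galois_sub p S a (p - 2)
  rw [inv_eq, pow_val_natCast (socleUnit_pow_prime hp hr), socleUnit_pow hp hr, socleUnit, map_add,
    map_one, map_smul, sub_eq_iff_eq_add.1 hc, smul_add, ← smul_mul_assoc,
    smul_zetaSubOne_pow_eq_zero hr (by omega), zero_mul, zero_add, smul_smul, mul_comm r,
    Nat.cast_pow]

/-- The representation of `DiagGroup p` on `S[ζ]` in which `(u, v)` acts as multiplication by
`ζ ^ u (1 + r (ζ - 1) ^ (p - 2)) ^ v` and `(ZMod p)ˣ` acts as the Galois group. -/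
noncomputable def stdRep (hp : 3 ≤ p) (r : S) (hr : (p : S) * r = 0) :
    Representation S (DiagGroup p) (AdjoinZeta p S) where
  toFun g := (LinearMap.mulLeft S (zeta p S ^ (Multiplicative.toAdd g.left).1.val *
    socleUnit p r ^ (Multiplicative.toAdd g.left).2.val)).comp (galois p S g.right).toLinearMap
  map_one' := by
    ext b
    simp
  map_mul' g h := by
    refine LinearMap.ext fun b => ?_
    have left_fst : (Multiplicative.toAdd (g * h).left).1 = (Multiplicative.toAdd g.left).1 +
        g.right * (Multiplicative.toAdd h.left).1 := by
      rw [SemidirectProduct.mul_left]; rfl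
    have left_snd : (Multiplicative.toAdd (g * h).left).2 = (Multiplicative.toAdd g.left).2 +
        (↑g.right⁻¹ : ZMod p) * (Multiplicative.toAdd h.left).2 := by
      rw [SemidirectProduct.mul_left]; rfl
    have hs := socleUnit_pow_prime hp hr
    simp only [LinearMap.comp_apply, LinearMap.mulLeft_apply, AlgHom.toLinearMap_apply, left_fst,
      left_snd, pow_val_add (zeta_pow p S), pow_val_add hs, pow_val_mul (zeta_pow p S),
      pow_val_mul hs, SemidirectProduct.mul_right, map_mul, Module.End.mul_apply,
      map_pow, galois_zeta, galois_socleUnit hp hr, AlgHom.mul_apply]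
    ring

section Apply

variable (hp : 3 ≤ p) {r : S} (hr : (p : S) * r = 0)

lemma stdRep_apply (g : DiagGroup p) (b : AdjoinZeta p S) :
    stdRep hp r hr g b = zeta p S ^ (Multiplicative.toAdd g.left).1.val *
      socleUnit p r ^ (Multiplicative.toAdd g.left).2.val * galois p S g.right b := rfl

lemma stdRep_inr (a : (ZMod p)ˣ) (b : AdjoinZeta p S) :
    stdRep hp r hr (SemidirectProduct.inr a) b = galois p S a b := by
  simp [stdRep_apply]

lemma stdRep_x (b : AdjoinZeta p S) : stdRep hp r hr (DiagGroup.x p) b = zeta p S * b := by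
  have : Fact (1 < p) := ⟨by omega⟩
  simp [stdRep_apply, DiagGroup.x, ZMod.val_one]

lemma stdRep_y (b : AdjoinZeta p S) : stdRep hp r hr (DiagGroup.y p) b = socleUnit p r * b := by
  have : Fact (1 < p) := ⟨by omega⟩
  simp [stdRep_apply, DiagGroup.y, ZMod.val_one]

end Apply

end StandardRepresentation

section BaseChange

variable {p : ℕ} {R S : Type*} [CommRing R] [CommRing S]

/-- The ring homomorphism `R[ζ] → S[ζ]` induced by `R → S`. -/
noncomputable def mapRingHom (p : ℕ) (α : R →+* S) : AdjoinZeta p R →+* AdjoinZeta p S :=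
  AdjoinRoot.map α (cyclotomic p R) (cyclotomic p S) (by rw [map_cyclotomic])

@[simp] lemma mapRingHom_zeta (α : R →+* S) : mapRingHom p α (zeta p R) = zeta p S := by
  simp [mapRingHom]

lemma mapRingHom_algebraMap (α : R →+* S) (r : R) :
    mapRingHom p α (algebraMap R _ r) = algebraMap S _ (α r) := by
  simp [mapRingHom]

@[simp] lemma mapRingHom_smul (α : R →+* S) (r : R) (b : AdjoinZeta p R) :
    mapRingHom p α (r • b) = α r • mapRingHom p α b := by
  rw [Algebra.smul_def, map_mul, mapRingHom_algebraMap, Algebra.smul_def]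

lemma mapRingHom_surjective {α : R →+* S} (h : Function.Surjective α) :
    Function.Surjective (mapRingHom p α) := by
  intro b
  obtain ⟨f, rfl⟩ := AdjoinRoot.mk_surjective b
  obtain ⟨f, rfl⟩ := Polynomial.map_surjective α h f
  refine ⟨AdjoinRoot.mk _ f, ?_⟩
  rw [mapRingHom, AdjoinRoot.map, AdjoinRoot.lift_mk, ← AdjoinRoot.aeval_eq, aeval_def, eval₂_map]
  rfl

lemma mapRingHom_socleUnit (α : R →+* S) (r : R) :
    mapRingHom p α (socleUnit p r) = socleUnit p (α r) := by
  simp [socleUnit, zetaSubOne]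

variable [Fact p.Prime]

lemma mapRingHom_galois (α : R →+* S) (a : (ZMod p)ˣ) (b : AdjoinZeta p R) :
    mapRingHom p α (galois p R a b) = galois p S a (mapRingHom p α b) := by
  have ringHom_eq : (mapRingHom p α).comp (galois p R a : AdjoinZeta p R →+* AdjoinZeta p R) =
      (galois p S a : AdjoinZeta p S →+* AdjoinZeta p S).comp (mapRingHom p α) := by
    apply AdjoinRoot.ringHom_ext
    · ext r
      simp [← AdjoinRoot.algebraMap_eq, mapRingHom_algebraMap]
    · simp
  exact RingHom.congr_fun ringHom_eq b

lemma mapRingHom_stdRep (hp : 3 ≤ p) (α : R →+* S) {r : R} (hr : (p : R) * r = 0) {s : S}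
    (hs : (p : S) * s = 0) (h : α r = s) (g : DiagGroup p) (b : AdjoinZeta p R) :
    mapRingHom p α (stdRep hp r hr g b) = stdRep hp s hs g (mapRingHom p α b) := by
  simp [stdRep_apply, mapRingHom_galois, mapRingHom_socleUnit, h]

variable [Algebra R S] [Nontrivial R] [Nontrivial S]

variable (p R S) in
/-- The base change isomorphism `S ⊗ R[ζ] ≃ S[ζ]`. -/
noncomputable def baseChangeEquiv : S ⊗[R] AdjoinZeta p R ≃ₗ[S] AdjoinZeta p S :=
  ((basis p R).baseChange S).equiv (basis p S) (Equiv.refl _)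

lemma baseChangeEquiv_tmul (s : S) (b : AdjoinZeta p R) :
    baseChangeEquiv p R S (s ⊗ₜ b) = s • mapRingHom p (algebraMap R S) b := by
  rw [← mul_one s, ← smul_eq_mul, ← TensorProduct.smul_tmul', map_smul, smul_eq_mul,
    mul_one]
  congr 1
  rw [← (basis p R).sum_repr b, TensorProduct.tmul_sum, map_sum, map_sum]
  refine Finset.sum_congr rfl fun i _ => ?_
  rw [mapRingHom_smul, TensorProduct.tmul_smul, ← algebraMap_smul S, map_smul,
    ← Module.Basis.baseChange_apply S (basis p R), baseChangeEquiv, Module.Basis.equiv_apply]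
  simp

end BaseChange

section Lift

variable {p : ℕ} [Fact p.Prime] {k : Type*} [Field k]

/-- The representation `stdRep` over `R`, as a lift of its reduction. -/
noncomputable def stdLift (hp : 3 ≤ p) {R : Type u} [CommRing R] [Nontrivial R] [Algebra R k]
    (r : R) (hr : (p : R) * r = 0) (h : algebraMap R k r = 0) :
    DefLift.{u} (stdRep hp (0 : k) (mul_zero _)) R where
  M := AdjoinZeta p R
  rep := stdRep hp r hr
  φ := baseChangeEquiv p R k
  equivariant g c m := by
    rw [baseChangeEquiv_tmul, baseChangeEquiv_tmul, mapRingHom_stdRep hp _ hr (mul_zero _) h,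
      map_smul]

end Lift

section CyclicVector

variable {p : ℕ} {S M : Type*} [CommRing S] [Nontrivial S] [AddCommGroup M] [Module S M]
  [Module.Free S M] [Module.Finite S M] {X : Module.End S M} {e : M}

lemma exists_linearEquiv_of_charpoly_eq (hX : X.charpoly = cyclotomic p S)
    (he : Function.Surjective fun f : S[X] => aeval X f e) :
    ∃ F : AdjoinZeta p S ≃ₗ[S] M, ∀ f, F (AdjoinRoot.mk _ f) = aeval X f e := by
  let θ : AdjoinZeta p S →ₐ[S] Module.End S M :=
    Ideal.Quotient.liftₐ (Ideal.span {cyclotomic p S}) (aeval X) fun f hf => by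
      obtain ⟨g, rfl⟩ := Ideal.mem_span_singleton.1 hf
      rw [map_mul, ← hX, LinearMap.aeval_self_charpoly, zero_mul]
  let F : AdjoinZeta p S →ₗ[S] M := (LinearMap.applyₗ e).comp θ.toLinearMap
  have F_mk (f : S[X]) : F (AdjoinRoot.mk _ f) = aeval X f e := rfl
  refine ⟨.ofBijective F ⟨?_, fun m => ?_⟩, F_mk⟩
  · rw [injective_iff_map_eq_zero]
    intro b hb
    obtain ⟨f, rfl⟩ := AdjoinRoot.mk_surjective b
    rwa [F_mk, ← charpoly_dvd_iff_aeval_apply_eq_zero he, hX, ← AdjoinRoot.mk_eq_zero] at hb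
  · obtain ⟨f, rfl⟩ := he m
    exact ⟨_, F_mk f⟩

end CyclicVector

lemma apply_eq_mul_apply_one {p : ℕ} {S B : Type*} [CommRing S] [Semiring B] [Algebra S B]
    (σ : AdjoinZeta p S →ₐ[S] B) {f : AdjoinZeta p S →ₗ[S] B}
    (hf : ∀ b, f (zeta p S * b) = σ (zeta p S) * f b) (b : AdjoinZeta p S) :
    f b = σ b * f 1 := by
  have zeta_pow_mul (n : ℕ) : f (zeta p S ^ n) = σ (zeta p S) ^ n * f 1 := by
    induction n with
    | zero => simp
    | succ n ih => rw [pow_succ', hf, ih, pow_succ', mul_assoc]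
  induction b using AdjoinRoot.induction_on with | ih g =>
  induction g using Polynomial.induction_on' with
  | add g h hg hh => rw [map_add, map_add, map_add, hg, hh, add_mul]
  | monomial n s =>
    rw [← C_mul_X_pow_eq_monomial, map_mul, map_pow, AdjoinRoot.mk_X, AdjoinRoot.mk_C,
      ← AdjoinRoot.algebraMap_eq, ← Algebra.smul_def, map_smul, map_smul, zeta_pow_mul, map_pow,
      smul_mul_assoc]

section Classification

variable {p : ℕ} [Fact p.Prime] {S : Type*} [CommRing S] [Nontrivial S]

lemma socleUnit_injective : Function.Injective (socleUnit p : S → AdjoinZeta p S) :=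
  fun _ _ h => smul_zetaSubOne_pow_injective p S (add_left_cancel h)

lemma eq_of_stdRep_equiv {hp : 3 ≤ p} {r s : S} {hr : (p : S) * r = 0} {hs : (p : S) * s = 0}
    (E : (stdRep hp r hr).Equiv (stdRep hp s hs)) : r = s := by
  have E_eq (b : AdjoinZeta p S) : E b = b * E 1 :=
    apply_eq_mul_apply_one (AlgHom.id S _) (f := E.toLinearMap) (fun b => by
      simpa [stdRep_x] using E.isIntertwining _ _ (DiagGroup.x p) b) b
  obtain ⟨b, hb⟩ := E.toLinearEquiv.surjective 1
  have hb' : b * E 1 = 1 := by rw [← E_eq]; exact hb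
  apply socleUnit_injective (p := p)
  have E_socleUnit : socleUnit p r * E 1 = socleUnit p s * E 1 := by
    simpa [stdRep_y, ← E_eq] using E.isIntertwining _ _ (DiagGroup.y p) 1
  exact (IsUnit.of_mul_eq_one_right _ hb').mul_right_cancel E_socleUnit

theorem exists_eq_stdRep (hp : 3 ≤ p) {I : Ideal S} (hI : I ≤ Ideal.jacobson ⊥) (hpI : (p : S) ∈ I)
    {τ : Representation S (DiagGroup p) (AdjoinZeta p S)}
    (inr_one : ∀ a, τ (SemidirectProduct.inr a) 1 = 1)
    (x_apply : ∀ b, τ (DiagGroup.x p) b = zeta p S * b)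
    (y_one : τ (DiagGroup.y p) 1 - 1 ∈ I.map (algebraMap S (AdjoinZeta p S))) :
    ∃ r ∈ I, ∃ hr, τ = stdRep hp r hr := by
  have x_pow_apply (n : ℕ) (b) : (τ (DiagGroup.x p) ^ n) b = zeta p S ^ n * b := by
    rw [show τ (DiagGroup.x p) = LinearMap.mulLeft S (zeta p S) from LinearMap.ext x_apply,
      LinearMap.pow_mulLeft, LinearMap.mulLeft_apply]
  have inr_apply (a : (ZMod p)ˣ) (b) : τ (SemidirectProduct.inr a) b = galois p S a b := by
    rw [apply_eq_mul_apply_one (galois p S a) (fun b => ?_) b, inr_one, mul_one]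
    rw [← x_apply, ← Module.End.mul_apply, ← map_mul, DiagGroup.inr_mul_x, map_mul, map_pow,
      Module.End.mul_apply, x_pow_apply, galois_zeta]
  set β := τ (DiagGroup.y p) 1 with hβ
  have y_apply (b) : τ (DiagGroup.y p) b = β * b := by
    rw [apply_eq_mul_apply_one (AlgHom.id S _) (fun b => ?_) b, AlgHom.id_apply, mul_comm]
    rw [← x_apply, ← Module.End.mul_apply, ← map_mul, ← DiagGroup.x_mul_y, map_mul,
      Module.End.mul_apply, x_apply, AlgHom.id_apply]
  have y_pow_apply (n : ℕ) (b) : (τ (DiagGroup.y p) ^ n) b = β ^ n * b := by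
    rw [show τ (DiagGroup.y p) = LinearMap.mulLeft S β from LinearMap.ext y_apply,
      LinearMap.pow_mulLeft, LinearMap.mulLeft_apply]
  have β_pow : β ^ p = 1 := by
    rw [← mul_one (β ^ p), ← y_pow_apply, ← map_pow, DiagGroup.y_pow_self, map_one τ,
      Module.End.one_apply]
  have galois_β (a : (ZMod p)ˣ) : galois p S a β = β ^ (↑a⁻¹ : ZMod p).val := by
    rw [← inr_apply, hβ, ← Module.End.mul_apply, ← map_mul, DiagGroup.inr_mul_y, map_mul,
      Module.End.mul_apply, inr_one, map_pow, y_pow_apply, mul_one]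
  obtain ⟨r, hrI, hr, β_eq⟩ := exists_eq_one_add_smul_zetaSubOne_pow hp hI hpI β_pow galois_β y_one
  refine ⟨r, hrI, hr, MonoidHom.ext fun g => LinearMap.ext fun b => ?_⟩
  conv_lhs => rw [DiagGroup.eq_mul g]
  rw [stdRep_apply, map_mul, map_mul, map_pow, map_pow, Module.End.mul_apply, Module.End.mul_apply,
    inr_apply, y_pow_apply, x_pow_apply, β_eq, socleUnit, mul_assoc]

end Classification

section Lifts

variable {p : ℕ} [Fact p.Prime] {k S : Type*} [Field k] [CommRing S] [Algebra S k] {hp : 3 ≤ p}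
  (L : DefLift (stdRep hp (0 : k) (mul_zero _)) S) {e : L.M}

lemma φ_aeval_x (hφe : L.φ (1 ⊗ₜ e) = 1) (f : S[X]) :
    L.φ (1 ⊗ₜ aeval (L.rep (DiagGroup.x p)) f e) =
      mapRingHom p (algebraMap S k) (AdjoinRoot.mk _ f) := by
  have φ_x_pow (n : ℕ) : L.φ (1 ⊗ₜ (L.rep (DiagGroup.x p) ^ n) e) = zeta p k ^ n := by
    induction n with
    | zero => simpa using hφe
    | succ n ih => rw [pow_succ', Module.End.mul_apply, L.equivariant, ih, stdRep_x, pow_succ']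
  induction f using Polynomial.induction_on' with
  | add f g hf hg =>
    rw [map_add, LinearMap.add_apply, TensorProduct.tmul_add, map_add, hf, hg, map_add, map_add]
  | monomial n s =>
    rw [← C_mul_X_pow_eq_monomial, map_mul, aeval_C, ← Algebra.smul_def, map_pow, aeval_X,
      LinearMap.smul_apply, TensorProduct.tmul_smul, ← algebraMap_smul k, map_smul, φ_x_pow,
      map_mul, map_pow, AdjoinRoot.mk_X, AdjoinRoot.mk_C, ← AdjoinRoot.algebraMap_eq,
      ← Algebra.smul_def, mapRingHom_smul, map_pow, mapRingHom_zeta]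

variable [IsCoefficientRing k S]

lemma aeval_x_apply_surjective (hφe : L.φ (1 ⊗ₜ e) = 1) :
    Function.Surjective fun f : S[X] => aeval (L.rep (DiagGroup.x p)) f e := by
  refine IsCoefficientRing.surjective_of_residue L.φ
    (f := (LinearMap.applyₗ e).comp (aeval (L.rep (DiagGroup.x p))).toLinearMap) fun m => ?_
  obtain ⟨b, hb⟩ := mapRingHom_surjective (p := p) (α := algebraMap S k)
    IsCoefficientRing.residue_surjective (L.φ (1 ⊗ₜ m))
  obtain ⟨f, rfl⟩ := AdjoinRoot.mk_surjective b
  exact ⟨f, (φ_aeval_x L hφe f).trans hb⟩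

lemma charpoly_x (hφe : L.φ (1 ⊗ₜ e) = 1) :
    (L.rep (DiagGroup.x p)).charpoly = cyclotomic p S := by
  obtain ⟨a, ha⟩ := exists_units_zmod_val_eq_two hp
  refine charpoly_eq_cyclotomic_prime (by omega) ?_ (aeval_x_apply_surjective L hφe) ?_
    ((Group.isUnit (SemidirectProduct.inr a)).map L.rep) ?_
  · rw [← Module.finrank_baseChange (R := k) (S := S), L.φ.finrank_eq, finrank_eq]
  · rw [← map_pow, DiagGroup.x_pow_self, map_one]
  · rw [← map_mul, DiagGroup.inr_mul_x, ha, map_mul, map_pow]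

lemma mem_map_maximalIdeal {b : AdjoinZeta p S} (hb : mapRingHom p (algebraMap S k) b = 0) :
    b ∈ (IsLocalRing.maximalIdeal S).map (algebraMap S (AdjoinZeta p S)) := by
  have tmul_eq_zero : (1 : k) ⊗ₜ[S] b = 0 :=
    (baseChangeEquiv p S k).injective (by rw [baseChangeEquiv_tmul, hb, smul_zero, map_zero])
  rw [← Submodule.restrictScalars_mem S, ← Ideal.smul_top_eq_map,
    ← IsCoefficientRing.ker_algebraMap k]
  exact mem_smul_top_of_one_tmul_eq_zero tmul_eq_zero

theorem exists_equiv_stdRep [CharP k p] :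
    ∃ r ∈ IsLocalRing.maximalIdeal S, ∃ hr, ∃ F : (stdRep hp r hr).Equiv L.rep,
      ∀ b, L.φ (1 ⊗ₜ F b) = mapRingHom p (algebraMap S k) b := by
  have card_unit : IsUnit (Fintype.card (ZMod p)ˣ : S) := by
    rw [IsCoefficientRing.isUnit_iff k, map_natCast, ZMod.card_units, Nat.cast_sub (by omega),
      CharP.cast_eq_zero]
    simp
  obtain ⟨e, e_fixed, hφe⟩ := L.exists_fixed_lift IsCoefficientRing.residue_surjective
    SemidirectProduct.inr card_unit (v := 1) (fun a => by rw [stdRep_inr, map_one])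
  obtain ⟨F, hF⟩ := exists_linearEquiv_of_charpoly_eq (charpoly_x L hφe)
    (aeval_x_apply_surjective L hφe)
  have F_one : F 1 = e := by simpa using hF 1
  have F_zeta (b) : F (zeta p S * b) = L.rep (DiagGroup.x p) (F b) := by
    obtain ⟨f, rfl⟩ := AdjoinRoot.mk_surjective b
    rw [zeta, ← AdjoinRoot.mk_X, ← map_mul, hF, hF, map_mul, aeval_X, Module.End.mul_apply]
  have φ_F (b) : L.φ (1 ⊗ₜ F b) = mapRingHom p (algebraMap S k) b := by
    obtain ⟨f, rfl⟩ := AdjoinRoot.mk_surjective b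
    rw [hF, φ_aeval_x L hφe]
  let τ : Representation S (DiagGroup p) (AdjoinZeta p S) :=
    (F.symm.conjRingEquiv : _ →* _).comp L.rep
  have F_τ (g b) : F (τ g b) = L.rep g (F b) := F.apply_symm_apply _
  obtain ⟨r, hrm, hr, hτ⟩ := exists_eq_stdRep hp
    (IsLocalRing.maximalIdeal_le_jacobson ⊥) (τ := τ)
    ((IsCoefficientRing.mem_maximalIdeal k).2 (by simp))
    (fun a => F.injective (by rw [F_τ, F_one, e_fixed]))
    (fun b => F.injective (by rw [F_τ, F_zeta]))
    (mem_map_maximalIdeal (k := k) (by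
      rw [map_sub, ← φ_F, F_τ, L.equivariant, φ_F, stdRep_y, map_one]
      simp [socleUnit]))
  exact ⟨r, hrm, hr, .mk F fun g => LinearMap.ext fun b => hτ ▸ F_τ g b, φ_F⟩

end Lifts

lemma mapRingHom_comp {p : ℕ} {R S T : Type*} [CommRing R] [CommRing S] [CommRing T]
    (β : S →+* T) (α : R →+* S) (b : AdjoinZeta p R) :
    mapRingHom p β (mapRingHom p α b) = mapRingHom p (β.comp α) b :=
  DFunLike.congr_fun (AdjoinRoot.map_comp_map α β (cyclotomic p R) (cyclotomic p S)
    (cyclotomic p T) (by rw [map_cyclotomic]) (by rw [map_cyclotomic])) b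

section ArisesFrom

variable {p : ℕ} [Fact p.Prime] {hp : 3 ≤ p} {k : Type*} [Field k] {R S : Type*} [CommRing R]
  [CommRing S] [Nontrivial R] [Nontrivial S] {t : R} {ht : (p : R) * t = 0} {r : S}
  {hr : (p : S) * r = 0}

lemma baseChangeEquiv_stdRep [Algebra R S] (h : algebraMap R S t = r) (g : DiagGroup p)
    (z : S ⊗[R] AdjoinZeta p R) :
    baseChangeEquiv p R S ((stdRep hp t ht g).baseChange S z) =
      stdRep hp r hr g (baseChangeEquiv p R S z) := by
  induction z using TensorProduct.induction_on with
  | zero => simp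
  | add z w hz hw => rw [map_add, map_add, hz, hw, map_add, map_add]
  | tmul s b =>
    rw [LinearMap.baseChange_tmul, baseChangeEquiv_tmul, baseChangeEquiv_tmul, map_smul,
      mapRingHom_stdRep hp _ ht hr h]

variable [Algebra R k] [Algebra S k] {ht0 : algebraMap R k t = 0}
  {L : DefLift (stdRep hp (0 : k) (mul_zero _)) S} {α : R →+* S}

lemma map_eq_of_arisesFrom (F : (stdRep hp r hr).Equiv L.rep)
    (h : L.ArisesFrom (stdLift hp t ht ht0) α) : α t = r := by
  let : Algebra R S := α.toAlgebra
  obtain ⟨E, hE, -⟩ := h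
  change S ⊗[R] AdjoinZeta p R ≃ₗ[S] L.M at E
  change ∀ g s b, E (s ⊗ₜ[R] stdRep hp t ht g b) = L.rep g (E (s ⊗ₜ[R] b)) at hE
  have hαt : (p : S) * α t = 0 := by rw [← map_natCast α, ← map_mul, ht, map_zero]
  have E_stdRep (g) (z : S ⊗[R] AdjoinZeta p R) :
      E ((stdRep hp t ht g).baseChange S z) = L.rep g (E z) := by
    induction z using TensorProduct.induction_on with
    | zero => simp
    | add z w hz hw => rw [map_add, map_add, hz, hw, map_add, map_add]
    | tmul s b => exact hE g s b
  let E' : (stdRep hp (α t) hαt).Equiv L.rep :=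
    .mk ((baseChangeEquiv p R S).symm.trans E) fun g => LinearMap.ext fun b => by
      obtain ⟨z, rfl⟩ := (baseChangeEquiv p R S).surjective b
      simp [← baseChangeEquiv_stdRep (ht := ht) (hr := hαt) rfl, E_stdRep]
  exact eq_of_stdRep_equiv (E'.trans F.symm)

lemma arisesFrom_of_map_eq (F : (stdRep hp r hr).Equiv L.rep)
    (hα : (algebraMap S k).comp α = algebraMap R k)
    (hφ : ∀ b, L.φ (1 ⊗ₜ F b) = mapRingHom p (algebraMap S k) b) (h : α t = r) :
    L.ArisesFrom (stdLift hp t ht ht0) α := by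
  let : Algebra R S := α.toAlgebra
  refine ⟨(baseChangeEquiv p R S).trans F.toLinearEquiv, fun g s (b : AdjoinZeta p R) => ?_,
    fun (b : AdjoinZeta p R) => ?_⟩
  · change F (baseChangeEquiv p R S ((stdRep hp t ht g).baseChange S (s ⊗ₜ b))) =
      L.rep g (F (baseChangeEquiv p R S (s ⊗ₜ b)))
    rw [baseChangeEquiv_stdRep h]
    exact F.isIntertwining _ _ g _
  · change L.φ (1 ⊗ₜ F (baseChangeEquiv p R S (1 ⊗ₜ b))) = baseChangeEquiv p R k (1 ⊗ₜ b)
    rw [baseChangeEquiv_tmul, baseChangeEquiv_tmul, one_smul, one_smul, hφ, mapRingHom_comp, ← hα]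
    rfl

end ArisesFrom

theorem exists_arisesFrom_iff {p : ℕ} [Fact p.Prime] {hp : 3 ≤ p} {k R S : Type*} [Field k]
    [CharP k p] [CommRing R] [Nontrivial R] [Algebra R k] [CommRing S] [Algebra S k]
    [IsCoefficientRing k S] {t : R} (ht : (p : R) * t = 0) (ht0 : algebraMap R k t = 0)
    (L : DefLift (stdRep hp (0 : k) (mul_zero _)) S) :
    ∃ r ∈ IsLocalRing.maximalIdeal S, (p : S) * r = 0 ∧ ∀ α : R →+* S,
      (algebraMap S k).comp α = algebraMap R k →
        (L.ArisesFrom (stdLift hp t ht ht0) α ↔ α t = r) := by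
  obtain ⟨r, hrm, hr, F, hφ⟩ := exists_equiv_stdRep L
  exact ⟨r, hrm, hr, fun α hα => ⟨map_eq_of_arisesFrom F, arisesFrom_of_map_eq F hα hφ⟩⟩

theorem isUniversalDeformationRing {p : ℕ} [Fact p.Prime] (hp : 3 ≤ p) {k : Type*} [Field k]
    [CharP k p] {R : Type u} [CommRing R] [Algebra R k] [IsCoefficientRing k R] (t : R)
    (ht : (p : R) * t = 0) (ht0 : algebraMap R k t = 0)
    (existsUnique : ∀ (S : Type v) [CommRing S] [Algebra S k] [IsCoefficientRing k S] (r : S),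
      r ∈ IsLocalRing.maximalIdeal S → (p : S) * r = 0 →
        ∃! α : R →+* S, (algebraMap S k).comp α = algebraMap R k ∧ α t = r) :
    IsUniversalDeformationRing.{u, v} (stdRep hp (0 : k) (mul_zero _)) R := by
  refine ⟨inferInstance, stdLift hp t ht ht0, fun S _ _ _ L => ?_⟩
  obtain ⟨r, hrm, hr, arisesFrom_iff⟩ := exists_arisesFrom_iff ht ht0 L
  obtain ⟨α, ⟨hα, hαt⟩, unique⟩ := existsUnique S r hrm hr
  exact ⟨α, ⟨hα, (arisesFrom_iff α hα).2 hαt⟩,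
    fun β ⟨hβ, hβL⟩ => unique β ⟨hβ, (arisesFrom_iff β hβ).1 hβL⟩⟩

section ResidueRepresentation

variable {p : ℕ} [Fact p.Prime]

lemma exists_eq_smul_one_of_galois_fixed (hp : 3 ≤ p) {S : Type*} [CommRing S] [CharP S p]
    {b : AdjoinZeta p S} (h : ∀ a : (ZMod p)ˣ, galois p S a b = b) : ∃ c : S, b = c • 1 := by
  have p_eq_zero : (p : S) = 0 := CharP.cast_eq_zero S p
  obtain ⟨c, hc⟩ := exists_zetaSubOne_dvd_sub_smul_one b
  have mem_filtration {i : ℕ} (h1 : 1 ≤ i) (hi : i ≤ p - 1) :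
      b - c • 1 ∈ filtration (⊤ : Ideal S) i := by
    induction i, h1 using Nat.le_induction with
    | base => rwa [mem_filtration_top_iff, pow_one]
    | succ i h1 ih =>
      obtain ⟨a, ha⟩ := exists_units_zmod_pow_ne_one (p := p) (i := i) (by omega) (by omega)
      refine mem_filtration_succ_of_galois_sub_smul_mem a (u := 1) ?_ (ih (by omega)) ?_
      · have : Fact (1 < p) := ⟨by omega⟩
        simpa [ZMod.val_one] using isUnit_val_pow_sub_val_of_mem_jacobson (B := S) (b := 1)
          (by simp) ha
      · simp [h]
  refine ⟨c, sub_eq_zero.1 (eq_zero_of_mem_filtration_torsionOf ?_)⟩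
  rw [p_eq_zero, Ideal.torsionOf_zero]
  exact mem_filtration (by omega) le_rfl

lemma zetaSubOne_pow_eq_zero (S : Type*) [CommRing S] [CharP S p] {n : ℕ} (hn : p - 1 ≤ n) :
    zetaSubOne p S ^ n = 0 := by
  simpa using smul_zetaSubOne_pow_eq_zero (S := S) (p := p) (r := 1) (by simp) hn

variable {k : Type*} [Field k]

local notation "π" => zetaSubOne p k

lemma zetaSubOne_pow_dvd_pow_iff [CharP k p] {i j : ℕ} (hi : i ≤ p - 1) :
    π ^ i ∣ π ^ j ↔ i ≤ j := by
  refine ⟨fun h => ?_, pow_dvd_pow π⟩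
  by_contra! hji
  have := (mul_dvd_mul_left (π ^ (p - 2 - j)) h)
  rw [← pow_add, ← pow_add, zetaSubOne_pow_eq_zero k (by omega), zero_dvd_iff,
    Nat.sub_add_cancel (by omega)] at this
  simpa [this] using topCoeff_zetaSubOne_pow p k

lemma isUnit_or_zetaSubOne_dvd [CharP k p] (b : AdjoinZeta p k) : IsUnit b ∨ π ∣ b := by
  obtain ⟨c, d, hd⟩ := exists_zetaSubOne_dvd_sub_smul_one b
  rw [sub_eq_iff_eq_add] at hd
  rcases eq_or_ne c 0 with rfl | hc
  · exact .inr ⟨d, by rw [hd, zero_smul, add_zero]⟩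
  · have isUnit_smul_one : IsUnit (c • (1 : AdjoinZeta p k)) := by
      rw [← Algebra.algebraMap_eq_smul_one]
      exact (IsUnit.mk0 c hc).map _
    have isNilpotent : IsNilpotent (π * d) :=
      ⟨p - 1, by rw [mul_pow, zetaSubOne_pow_eq_zero k le_rfl, zero_mul]⟩
    exact .inl (hd ▸ isNilpotent.isUnit_add_right_of_commute isUnit_smul_one (Commute.all _ _))

lemma exists_associated_zetaSubOne_pow [CharP k p] (b : AdjoinZeta p k) :
    ∃ j, Associated b (π ^ j) := by
  rcases eq_or_ne b 0 with rfl | hb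
  · exact ⟨p - 1, by rw [zetaSubOne_pow_eq_zero k le_rfl]⟩
  have finite : FiniteMultiplicity π b :=
    ⟨p - 1, by rwa [zetaSubOne_pow_eq_zero k (Nat.le_succ _), zero_dvd_iff]⟩
  obtain ⟨u, hu, not_dvd⟩ := finite.exists_eq_pow_mul_and_not_dvd
  have isUnit_u := (isUnit_or_zetaSubOne_dvd u).resolve_right not_dvd
  exact ⟨_, hu ▸ associated_mul_unit_left _ u isUnit_u⟩

section Subrepresentation

variable {hp : 3 ≤ p}

lemma mul_mem_subrepresentation {S : Type*} [CommRing S] {r : S} {hr : (p : S) * r = 0}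
    (W : Subrepresentation (stdRep hp r hr)) {b : AdjoinZeta p S} (f : AdjoinZeta p S)
    (hb : b ∈ W) : f * b ∈ W := by
  have hf : f ∈ Algebra.adjoin S {zeta p S} := by
    rw [AdjoinRoot.adjoinRoot_eq_top]
    exact Algebra.mem_top
  induction hf using Algebra.adjoin_induction generalizing b with
  | mem f hf =>
    rw [Set.mem_singleton_iff.1 hf, ← stdRep_x hp hr]
    exact W.apply_mem_toSubmodule _ hb
  | algebraMap s =>
    rw [← Algebra.smul_def]
    exact W.toSubmodule.smul_mem s hb
  | add f g _ _ ihf ihg =>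
    rw [add_mul]
    exact W.toSubmodule.add_mem (ihf hb) (ihg hb)
  | mul f g _ _ ihf ihg =>
    rw [mul_assoc]
    exact ihf (ihg hb)

/-- The subrepresentation `π ^ i S[ζ]` of `S[ζ]`. -/
noncomputable def powSubrepresentation {S : Type*} [CommRing S] {r : S} (hr : (p : S) * r = 0)
    (i : ℕ) : Subrepresentation (stdRep hp r hr) where
  toSubmodule := (Ideal.span {zetaSubOne p S ^ i}).restrictScalars S
  apply_mem_toSubmodule g b hb := by
    obtain ⟨u, hu, -⟩ := exists_galois_zetaSubOne_eq p S g.right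
    rw [Submodule.restrictScalars_mem, Ideal.mem_span_singleton] at hb ⊢
    have galois_dvd := map_dvd (galois p S g.right) hb
    rw [map_pow, hu, mul_pow] at galois_dvd
    rw [stdRep_apply]
    exact (dvd_of_mul_right_dvd galois_dvd).mul_left _

lemma mem_powSubrepresentation {S : Type*} [CommRing S] {r : S} {hr : (p : S) * r = 0} {i : ℕ}
    {b : AdjoinZeta p S} :
    b ∈ powSubrepresentation (hp := hp) hr i ↔ zetaSubOne p S ^ i ∣ b :=
  Ideal.mem_span_singleton

variable [CharP k p]

lemma powSubrepresentation_le_iff {i j : ℕ} (hj : j ≤ p - 1) :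
    powSubrepresentation (hp := hp) (mul_zero (p : k)) i ≤
      powSubrepresentation (mul_zero (p : k)) j ↔ j ≤ i := by
  rw [← zetaSubOne_pow_dvd_pow_iff (k := k) hj]
  refine ⟨fun h => mem_powSubrepresentation.1 (h (mem_powSubrepresentation.2 dvd_rfl)),
    fun h b hb => ?_⟩
  exact mem_powSubrepresentation.2 (h.trans (mem_powSubrepresentation.1 hb))

lemma exists_eq_powSubrepresentation (W : Subrepresentation (stdRep hp (0 : k) (mul_zero _))) :
    ∃ i ≤ p - 1, W = powSubrepresentation (mul_zero _) i := by
  classical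
  have pow_mem : π ^ (p - 1) ∈ W := by
    rw [zetaSubOne_pow_eq_zero k le_rfl]
    exact W.toSubmodule.zero_mem
  have exists_pow_mem : ∃ i, π ^ i ∈ W := ⟨_, pow_mem⟩
  refine ⟨Nat.find exists_pow_mem, Nat.find_le pow_mem, SetLike.ext fun b => ?_⟩
  rw [mem_powSubrepresentation]
  constructor
  · intro hb
    obtain ⟨j, u, hj⟩ := exists_associated_zetaSubOne_pow b
    have hjW : π ^ j ∈ W := by rw [← hj, mul_comm]; exact mul_mem_subrepresentation W u hb
    exact (pow_dvd_pow π (Nat.find_le hjW)).trans (Associated.symm ⟨u, hj⟩).dvd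
  · rintro ⟨c, rfl⟩
    rw [mul_comm]
    exact mul_mem_subrepresentation W c (Nat.find_spec exists_pow_mem)

theorem nonempty_submodule_orderIso (hp : 3 ≤ p) :
    Nonempty ((Fin (p - 1 + 1))ᵒᵈ ≃o Submodule (MonoidAlgebra k (DiagGroup p))
      (stdRep hp (0 : k) (mul_zero _)).asModule) := by
  let powSubrep (i : (Fin (p - 1 + 1))ᵒᵈ) : Subrepresentation (stdRep hp (0 : k) (mul_zero _)) :=
    powSubrepresentation (mul_zero _) (OrderDual.ofDual i : Fin (p - 1 + 1))
  have le_iff (i j : (Fin (p - 1 + 1))ᵒᵈ) : powSubrep i ≤ powSubrep j ↔ i ≤ j :=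
    powSubrepresentation_le_iff (Nat.lt_succ_iff.1 (OrderDual.ofDual j).is_lt)
  have surjective : Function.Surjective powSubrep := fun W => by
    obtain ⟨i, hi, rfl⟩ := exists_eq_powSubrepresentation W
    exact ⟨OrderDual.toDual ⟨i, Nat.lt_succ_iff.2 hi⟩, rfl⟩
  exact ⟨(RelIso.ofSurjective (OrderEmbedding.ofMapLEIff powSubrep le_iff)
    surjective).trans Subrepresentation.subrepresentationSubmoduleOrderIso⟩

variable (k) in
theorem isUniserialModule (hp : 3 ≤ p) : IsUniserialModule (MonoidAlgebra k (DiagGroup p))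
    (stdRep hp (0 : k) (mul_zero _)).asModule := fun N₁ N₂ => by
  obtain ⟨E⟩ := nonempty_submodule_orderIso (k := k) hp
  simpa using le_total (E.symm N₁) (E.symm N₂)

variable (k) in
theorem length_eq (hp : 3 ≤ p) : Module.length (MonoidAlgebra k (DiagGroup p))
    (stdRep hp (0 : k) (mul_zero _)).asModule = (p - 1 : ℕ) := by
  obtain ⟨E⟩ := nonempty_submodule_orderIso (k := k) hp
  rw [← WithBot.coe_inj, Module.coe_length, ← Order.krullDim_eq_of_orderIso E,
    Order.krullDim_orderDual, krullDim_fin_succ]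
  rfl

end Subrepresentation

variable (k) in
theorem nonempty_end_algEquiv [CharP k p] (hp : 3 ≤ p) :
    Nonempty (Module.End (MonoidAlgebra k (DiagGroup p))
      (stdRep hp (0 : k) (mul_zero _)).asModule ≃ₐ[k] k) := by
  let ρ := stdRep hp (0 : k) (mul_zero _)
  have surjective : Function.Surjective (Algebra.ofId k (ρ.IntertwiningMap ρ)) := fun f => by
    have f_eq (b : AdjoinZeta p k) : f b = b * f 1 :=
      apply_eq_mul_apply_one (AlgHom.id k _) (f := f.toLinearMap) (fun b => by
        simpa [ρ, stdRep_x] using f.isIntertwining _ _ (DiagGroup.x p) b) b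
    obtain ⟨c, hc⟩ := exists_eq_smul_one_of_galois_fixed hp (b := f 1) fun a => by
      simpa [ρ, stdRep_inr] using (f.isIntertwining _ _ (SemidirectProduct.inr a) 1).symm
    refine ⟨c, DFunLike.ext _ _ fun b => ?_⟩
    rw [f_eq, hc, mul_smul_comm, mul_one, Algebra.ofId_apply, Algebra.algebraMap_eq_smul_one]
    rfl
  have : Nontrivial ρ.asModule := Module.nontrivial_of_finrank_pos (R := k) (M := AdjoinZeta p k)
    (by rw [finrank_eq]; omega)
  have : Nontrivial (ρ.IntertwiningMap ρ) :=
    (Representation.IntertwiningMap.equivAlgEnd ρ).toEquiv.nontrivial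
  exact ⟨((AlgEquiv.ofBijective _ ⟨RingHom.injective _, surjective⟩).trans
    (Representation.IntertwiningMap.equivAlgEnd ρ)).symm⟩

end ResidueRepresentation

end AdjoinZeta

end Cyclotomic

section PowerSeries

open PowerSeries

lemma not_module_finite_powerSeries (S : Type*) [CommRing S] [Nontrivial S] :
    ¬ Module.Finite S S⟦X⟧ := fun _ => by
  have linearIndependent : LinearIndependent S fun n : ℕ => (X : S⟦X⟧) ^ n := by
    have := (Polynomial.basisMonomials S).linearIndependent.map'
      (Polynomial.coeToPowerSeries.algHom S).toLinearMap (LinearMap.ker_eq_bot.2 (by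
        simp [Function.Injective]))
    simpa [Function.comp_def, X_pow_eq] using this
  have := linearIndependent.finite
  exact not_finite ℕ

lemma exists_powerSeries_ringHom_of_isAdicComplete {A S : Type*} [CommRing A] [CommRing S]
    (I : Ideal S) [IsAdicComplete I S] (φ : A →+* S) {r : S} (hr : r ∈ I) :
    ∃ α : A⟦X⟧ →+* S, α X = r := by
  let : UniformSpace A := ⊥
  let (n : ℕ) : UniformSpace (S ⧸ I ^ n) := ⊥
  have hasEval (n : ℕ) : HasEval (Ideal.Quotient.mk (I ^ n) r) := by
    refine IsNilpotent.isTopologicallyNilpotent ⟨n, ?_⟩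
    rw [← map_pow, Ideal.Quotient.eq_zero_iff_mem]
    exact Ideal.pow_mem_pow hr n
  let ψ (n : ℕ) : A⟦X⟧ →+* S ⧸ I ^ n :=
    eval₂Hom (φ := (Ideal.Quotient.mk (I ^ n)).comp φ) continuous_of_discreteTopology (hasEval n)
  have factorPow_comp {m n : ℕ} (hmn : m ≤ n) :
      (Ideal.Quotient.factorPow I hmn).comp (ψ n) = ψ m := RingHom.ext fun f => by
    rw [RingHom.comp_apply, coe_eval₂Hom, coe_eval₂Hom]
    exact congrFun (comp_eval₂ continuous_of_discreteTopology (hasEval n)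
      continuous_of_discreteTopology) f
  refine ⟨IsAdicComplete.liftRingHom I ψ factorPow_comp,
    (IsHausdorff.eq_iff_smodEq (I := I)).2 fun n => ?_⟩
  rw [smul_eq_mul, Ideal.mul_top, SModEq.sub_mem, ← Ideal.Quotient.eq,
    IsAdicComplete.mk_liftRingHom, coe_eval₂Hom, PowerSeries.eval₂_X]

lemma nonempty_padicInt_ringHom_of_isAdicComplete {p : ℕ} [Fact p.Prime] {S : Type*} [CommRing S]
    (I : Ideal S) [IsAdicComplete I S] (hp : (p : S) ∈ I) : Nonempty (ℤ_[p] →+* S) := by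
  have ringChar_dvd (n : ℕ) : ringChar (S ⧸ I ^ n) ∣ p ^ n := by
    rw [← CharP.cast_eq_zero_iff (S ⧸ I ^ n) (ringChar (S ⧸ I ^ n)), Nat.cast_pow,
      ← map_natCast (Ideal.Quotient.mk (I ^ n)), ← map_pow, Ideal.Quotient.eq_zero_iff_mem]
    exact Ideal.pow_mem_pow hp n
  refine ⟨IsAdicComplete.liftRingHom I
    (fun n => (ZMod.castHom (ringChar_dvd n) (S ⧸ I ^ n)).comp (PadicInt.toZModPow n))
    fun {m n} hmn => ?_⟩
  rw [← PadicInt.zmod_cast_comp_toZModPow m n hmn, ← RingHom.comp_assoc, ← RingHom.comp_assoc]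
  congr 1
  exact Subsingleton.elim _ _

lemma toZMod_eq_zero_iff_dvd {p : ℕ} [Fact p.Prime] {a : ℤ_[p]} :
    PadicInt.toZMod a = 0 ↔ (p : ℤ_[p]) ∣ a := by
  rw [← RingHom.mem_ker, PadicInt.ker_toZMod, PadicInt.maximalIdeal_eq_span_p,
    Ideal.mem_span_singleton]

/-- The fibre product `ℤ_p ×_{F_p} F_p⟦X⟧`, a model of `ℤ_p⟦X⟧ / (p X)` in which completeness
and the powers of the maximal ideal can be read off the two factors. -/
def PullbackRing (p : ℕ) [Fact p.Prime] : Type :=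
  RingHom.eqLocus ((PadicInt.toZMod (p := p)).comp (RingHom.fst ℤ_[p] (ZMod p)⟦X⟧))
    ((constantCoeff (R := ZMod p)).comp (RingHom.snd ℤ_[p] (ZMod p)⟦X⟧))

namespace PullbackRing

variable (p : ℕ) [Fact p.Prime]

noncomputable instance : CommRing (PullbackRing p) :=
  inferInstanceAs (CommRing (RingHom.eqLocus _ _))

/-- The projection of the fibre product onto `ℤ_p`. -/
noncomputable def fst : PullbackRing p →+* ℤ_[p] :=
  (RingHom.fst ℤ_[p] (ZMod p)⟦X⟧).comp (Subring.subtype _)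

/-- The projection of the fibre product onto `F_p⟦X⟧`. -/
noncomputable def snd : PullbackRing p →+* (ZMod p)⟦X⟧ :=
  (RingHom.snd ℤ_[p] (ZMod p)⟦X⟧).comp (Subring.subtype _)

noncomputable instance : Algebra (PullbackRing p) (ZMod p) :=
  ((PadicInt.toZMod (p := p)).comp (fst p)).toAlgebra

/-- The element `(0, X)` of the fibre product, the image of `X` under `ofPowerSeries`. -/
noncomputable def t : PullbackRing p := ⟨(0, X), by simp [RingHom.mem_eqLocus]⟩

/-- The homomorphism `ℤ_p⟦X⟧ → ℤ_p ×_{F_p} F_p⟦X⟧` given by the constant coefficient and by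
reduction modulo `p`. -/
noncomputable def ofPowerSeries : ℤ_[p]⟦X⟧ →+* PullbackRing p :=
  ((constantCoeff (R := ℤ_[p])).prod (PowerSeries.map PadicInt.toZMod)).codRestrict
    (RingHom.eqLocus _ _) fun f => by
      change PadicInt.toZMod (constantCoeff f) = constantCoeff (PowerSeries.map PadicInt.toZMod f)
      simp only [← coeff_zero_eq_constantCoeff_apply, coeff_map]

variable {p}

lemma algebraMap_apply (x : PullbackRing p) :
    algebraMap (PullbackRing p) (ZMod p) x = PadicInt.toZMod (fst p x) := rfl

lemma toZMod_fst (x : PullbackRing p) :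
    PadicInt.toZMod (fst p x) = constantCoeff (snd p x) := x.2

@[ext] lemma ext {x y : PullbackRing p} (hfst : fst p x = fst p y) (hsnd : snd p x = snd p y) :
    x = y := Subtype.ext (Prod.ext hfst hsnd)

lemma exists_of_eq {a : ℤ_[p]} {f : (ZMod p)⟦X⟧} (h : PadicInt.toZMod a = constantCoeff f) :
    ∃ x : PullbackRing p, fst p x = a ∧ snd p x = f := ⟨⟨(a, f), h⟩, rfl, rfl⟩

lemma fst_surjective : Function.Surjective (fst p) := fun a =>
  let ⟨x, hx, _⟩ := exists_of_eq (a := a) (f := C (PadicInt.toZMod a)) (by simp)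
  ⟨x, hx⟩

lemma snd_surjective : Function.Surjective (snd p) := fun f =>
  let ⟨_, ha⟩ := ZMod.ringHom_surjective PadicInt.toZMod (constantCoeff f)
  let ⟨x, _, hx⟩ := exists_of_eq ha
  ⟨x, hx⟩

@[simp] lemma fst_t : fst p (t p) = 0 := rfl

@[simp] lemma snd_t : snd p (t p) = X := rfl

@[simp] lemma fst_ofPowerSeries (f : ℤ_[p]⟦X⟧) :
    fst p (ofPowerSeries p f) = constantCoeff f := rfl

@[simp] lemma snd_ofPowerSeries (f : ℤ_[p]⟦X⟧) :
    snd p (ofPowerSeries p f) = PowerSeries.map PadicInt.toZMod f := rfl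

lemma snd_natCast : snd p p = 0 := by
  rw [map_natCast, ← map_natCast (C (R := ZMod p)), ZMod.natCast_self, map_zero]

lemma p_mul_t : (p : PullbackRing p) * t p = 0 := by
  ext1
  · simp
  · rw [map_mul, snd_natCast, zero_mul, map_zero]

lemma algebraMap_t : algebraMap (PullbackRing p) (ZMod p) (t p) = 0 := by
  simp [algebraMap_apply]

lemma ofPowerSeries_X : ofPowerSeries p X = t p := by ext1 <;> simp

lemma ofPowerSeries_surjective : Function.Surjective (ofPowerSeries p) := by
  intro x
  choose lift toZMod_lift using ZMod.ringHom_surjective (PadicInt.toZMod (p := p))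
  refine ⟨mk fun n => if n = 0 then fst p x else lift (coeff n (snd p x)), ?_⟩
  ext1
  · rw [fst_ofPowerSeries, ← coeff_zero_eq_constantCoeff_apply, coeff_mk, if_pos rfl]
  · ext n
    rw [snd_ofPowerSeries, coeff_map, coeff_mk]
    split_ifs with h
    · rw [h, toZMod_fst, coeff_zero_eq_constantCoeff_apply]
    · rw [toZMod_lift]

lemma ker_ofPowerSeries : RingHom.ker (ofPowerSeries p) = Ideal.span {C (p : ℤ_[p]) * X} := by
  apply le_antisymm
  · intro f (hf : ofPowerSeries p f = 0)
    obtain ⟨g, rfl⟩ : X ∣ f := X_dvd_iff.2 (by rw [← fst_ofPowerSeries, hf, map_zero])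
    have p_dvd_coeff (n) : (p : ℤ_[p]) ∣ coeff n g := by
      simpa [coeff_succ_X_mul, toZMod_eq_zero_iff_dvd] using
        congrArg (fun x => coeff (n + 1) (snd p x)) hf
    choose c hc using p_dvd_coeff
    have hg : g = C (p : ℤ_[p]) * mk c := by ext n; rw [coeff_C_mul, coeff_mk, hc]
    exact Ideal.mem_span_singleton.2 ⟨mk c, by rw [hg]; ring⟩
  · rw [Ideal.span_singleton_le_iff_mem, RingHom.mem_ker, map_mul, ofPowerSeries_X, map_natCast,
      map_natCast, p_mul_t]

variable (p) in
/-- The presentation of the fibre product as `ℤ_p⟦X⟧ / (p X)`. -/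
noncomputable def equivQuotient :
    PullbackRing p ≃+* ℤ_[p]⟦X⟧ ⧸ Ideal.span {C (p : ℤ_[p]) * X} :=
  ((Ideal.quotEquivOfEq ker_ofPowerSeries.symm).trans
    (RingHom.quotientKerEquivOfSurjective ofPowerSeries_surjective)).symm

instance : Nontrivial (PullbackRing p) := (algebraMap (PullbackRing p) (ZMod p)).domain_nontrivial

instance : IsLocalRing (PullbackRing p) :=
  IsLocalRing.of_surjective' (ofPowerSeries p) ofPowerSeries_surjective

instance : IsNoetherianRing (PullbackRing p) :=
  isNoetherianRing_of_surjective _ _ (ofPowerSeries p) ofPowerSeries_surjective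

lemma mem_maximalIdeal {x : PullbackRing p} :
    x ∈ IsLocalRing.maximalIdeal (PullbackRing p) ↔ PadicInt.toZMod (fst p x) = 0 := by
  rw [← IsLocalRing.eq_maximalIdeal (RingHom.ker_isMaximal_of_surjective
    (algebraMap (PullbackRing p) (ZMod p)) (ZMod.ringHom_surjective _)), RingHom.mem_ker,
    algebraMap_apply]

lemma exists_of_dvd {x : PullbackRing p} {n : ℕ} (hfst : (p : ℤ_[p]) ^ n ∣ fst p x)
    (hsnd : X ^ n ∣ snd p x) : ∃ a b : PullbackRing p, x = p ^ n * a + t p ^ n * b := by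
  rcases eq_or_ne n 0 with rfl | hn
  · exact ⟨x, 0, by simp⟩
  obtain ⟨a, ha⟩ := hfst
  obtain ⟨f, hf⟩ := hsnd
  obtain ⟨a, rfl⟩ := fst_surjective a
  obtain ⟨b, rfl⟩ := snd_surjective f
  refine ⟨a, b, ?_⟩
  ext1
  · simp [ha, hn]
  · rw [map_add, map_mul, map_pow, snd_natCast, zero_pow hn, zero_mul, zero_add, map_mul, map_pow,
      snd_t, hf]

lemma mem_maximalIdeal_pow {x : PullbackRing p} {n : ℕ} :
    x ∈ IsLocalRing.maximalIdeal (PullbackRing p) ^ n ↔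
      (p : ℤ_[p]) ^ n ∣ fst p x ∧ X ^ n ∣ snd p x := by
  constructor
  · intro hx
    have le_comap_fst : IsLocalRing.maximalIdeal (PullbackRing p) ≤
        (Ideal.span {(p : ℤ_[p])}).comap (fst p) := fun y hy => by
      rw [Ideal.mem_comap, Ideal.mem_span_singleton, ← toZMod_eq_zero_iff_dvd]
      exact mem_maximalIdeal.1 hy
    have le_comap_snd : IsLocalRing.maximalIdeal (PullbackRing p) ≤
        (Ideal.span {(X : (ZMod p)⟦X⟧)}).comap (snd p) := fun y hy => by
      rw [Ideal.mem_comap, Ideal.mem_span_singleton, X_dvd_iff, ← toZMod_fst]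
      exact mem_maximalIdeal.1 hy
    have hfst := Ideal.le_comap_pow (fst p) n (Ideal.pow_right_mono le_comap_fst n hx)
    have hsnd := Ideal.le_comap_pow (snd p) n (Ideal.pow_right_mono le_comap_snd n hx)
    rw [Ideal.mem_comap, Ideal.span_singleton_pow, Ideal.mem_span_singleton] at hfst hsnd
    exact ⟨hfst, hsnd⟩
  · rintro ⟨hfst, hsnd⟩
    obtain ⟨a, b, rfl⟩ := exists_of_dvd hfst hsnd
    refine add_mem (Ideal.mul_mem_right _ _ (Ideal.pow_mem_pow (mem_maximalIdeal.2 ?_) n))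
      (Ideal.mul_mem_right _ _ (Ideal.pow_mem_pow (mem_maximalIdeal.2 ?_) n)) <;> simp

lemma smodEq_maximalIdeal_pow_iff {x y : PullbackRing p} {n : ℕ} :
    x ≡ y [SMOD (IsLocalRing.maximalIdeal (PullbackRing p) ^ n • ⊤ : Ideal (PullbackRing p))] ↔
      fst p x ≡ fst p y [SMOD (IsLocalRing.maximalIdeal ℤ_[p] ^ n • ⊤ : Ideal ℤ_[p])] ∧
        snd p x ≡ snd p y [SMOD Ideal.span {(X : (ZMod p)⟦X⟧)} ^ n • (⊤ : Ideal (ZMod p)⟦X⟧)] := by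
  simp only [smul_eq_mul, Ideal.mul_top, SModEq.sub_mem, mem_maximalIdeal_pow, map_sub,
    PadicInt.maximalIdeal_eq_span_p, Ideal.span_singleton_pow, Ideal.mem_span_singleton]

instance : IsHausdorff (IsLocalRing.maximalIdeal (PullbackRing p)) (PullbackRing p) where
  haus' x hx := by
    simp only [smodEq_maximalIdeal_pow_iff] at hx
    ext1
    · exact IsHausdorff.eq_iff_smodEq.2 fun n => (hx n).1
    · exact IsHausdorff.eq_iff_smodEq.2 fun n => (hx n).2

instance : IsPrecomplete (IsLocalRing.maximalIdeal (PullbackRing p)) (PullbackRing p) where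
  prec' x hx := by
    simp only [smodEq_maximalIdeal_pow_iff] at hx ⊢
    obtain ⟨a, ha⟩ := IsPrecomplete.prec inferInstance fun hmn => (hx hmn).1
    obtain ⟨f, hf⟩ := IsPrecomplete.prec inferInstance fun hmn => (hx hmn).2
    have toZMod_eq : PadicInt.toZMod a = constantCoeff f := by
      have ha₁ := ha 1
      have hf₁ := hf 1
      rw [smul_eq_mul, Ideal.mul_top, pow_one, SModEq.sub_mem] at ha₁ hf₁
      rw [← PadicInt.ker_toZMod, RingHom.mem_ker, map_sub, sub_eq_zero] at ha₁
      rw [Ideal.mem_span_singleton, X_dvd_iff, map_sub, sub_eq_zero] at hf₁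
      rw [← ha₁, ← hf₁, toZMod_fst]
    obtain ⟨y, rfl, rfl⟩ := exists_of_eq toZMod_eq
    exact ⟨y, fun n => ⟨ha n, hf n⟩⟩

instance : IsCoefficientRing (ZMod p) (PullbackRing p) where
  residue_surjective := ZMod.ringHom_surjective _
  complete := {}

lemma exists_eq_natCast_add (x : PullbackRing p) :
    ∃ (n : ℕ) (a b : PullbackRing p), x = n + p * a + t p * b := by
  let n := (algebraMap (PullbackRing p) (ZMod p) x).val
  have hn : x - n ∈ IsLocalRing.maximalIdeal (PullbackRing p) ^ 1 := by
    rw [pow_one, mem_maximalIdeal, map_sub, map_sub, ← algebraMap_apply, map_natCast, map_natCast,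
      ZMod.natCast_zmod_val, sub_self]
  obtain ⟨hfst, hsnd⟩ := mem_maximalIdeal_pow.1 hn
  obtain ⟨a, b, hab⟩ := exists_of_dvd hfst hsnd
  rw [pow_one, pow_one] at hab
  exact ⟨n, a, b, by rw [add_assoc, ← hab, add_sub_cancel]⟩

lemma ker_snd : RingHom.ker (snd p) = Ideal.span {(p : PullbackRing p)} := by
  apply le_antisymm
  · intro x (hx : snd p x = 0)
    obtain ⟨a, ha⟩ : (p : ℤ_[p]) ∣ fst p x := by
      rw [← toZMod_eq_zero_iff_dvd, toZMod_fst, hx, map_zero]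
    obtain ⟨y, rfl⟩ := fst_surjective a
    refine Ideal.mem_span_singleton.2 ⟨y, ?_⟩
    ext1
    · rw [ha, map_mul, map_natCast]
    · rw [hx, map_mul, snd_natCast, zero_mul]
  · rw [Ideal.span_singleton_le_iff_mem, RingHom.mem_ker, snd_natCast]

variable (p) in
/-- Reduction modulo `p` of the fibre product is its projection onto `F_p⟦X⟧`. -/
noncomputable def modPEquiv :
    PullbackRing p ⧸ Ideal.span {(p : PullbackRing p)} ≃+* (ZMod p)⟦X⟧ :=
  (Ideal.quotEquivOfEq ker_snd.symm).trans
    (RingHom.quotientKerEquivOfSurjective snd_surjective)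

variable (p) in
theorem exists_algebra_quotient :
    ∃ _ : Algebra (ZMod p) (PullbackRing p ⧸ Ideal.span {(p : PullbackRing p)}),
      Nonempty ((PullbackRing p ⧸ Ideal.span {(p : PullbackRing p)}) ≃ₐ[ZMod p] (ZMod p)⟦X⟧) ∧
      ¬ Module.Finite (ZMod p) (PullbackRing p ⧸ Ideal.span {(p : PullbackRing p)}) := by
  let algebra : Algebra (ZMod p) (PullbackRing p ⧸ Ideal.span {(p : PullbackRing p)}) :=
    (((modPEquiv p).symm : (ZMod p)⟦X⟧ →+* _).comp C).toAlgebra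
  let e : (PullbackRing p ⧸ Ideal.span {(p : PullbackRing p)}) ≃ₐ[ZMod p] (ZMod p)⟦X⟧ :=
    AlgEquiv.ofRingEquiv (f := modPEquiv p) fun c => (modPEquiv p).apply_symm_apply _
  exact ⟨algebra, ⟨e⟩, fun _ =>
    not_module_finite_powerSeries (ZMod p) (Module.Finite.equiv e.toLinearEquiv)⟩

variable {S : Type*} [CommRing S]

lemma exists_ringHom (I : Ideal S) [IsAdicComplete I S] (hp : (p : S) ∈ I) {r : S} (hrI : r ∈ I)
    (hr : (p : S) * r = 0) : ∃ α : PullbackRing p →+* S, α (t p) = r := by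
  obtain ⟨φ⟩ := nonempty_padicInt_ringHom_of_isAdicComplete I hp
  obtain ⟨α, hα⟩ := exists_powerSeries_ringHom_of_isAdicComplete I φ hrI
  have ker_le : RingHom.ker (ofPowerSeries p) ≤ RingHom.ker α := by
    rw [ker_ofPowerSeries, Ideal.span_singleton_le_iff_mem, RingHom.mem_ker, map_mul, hα,
      map_natCast, map_natCast, hr]
  refine ⟨(ofPowerSeries p).liftOfSurjective ofPowerSeries_surjective ⟨α, ker_le⟩, ?_⟩
  rw [← ofPowerSeries_X, ← hα]
  exact RingHom.liftOfRightInverse_comp_apply _ _ _ ⟨α, ker_le⟩ _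

lemma ringHom_ext_of_isHausdorff (I : Ideal S) [IsHausdorff I S] (hp : (p : S) ∈ I)
    {α β : PullbackRing p →+* S} (hα : α (t p) ∈ I) (h : α (t p) = β (t p)) : α = β := by
  have sub_mem (n x) : α x - β x ∈ I ^ n := by
    induction n generalizing x with
    | zero => simp
    | succ n ih =>
      obtain ⟨m, a, b, rfl⟩ := exists_eq_natCast_add x
      have sub_eq : α (m + p * a + t p * b) - β (m + p * a + t p * b) =
          p * (α a - β a) + α (t p) * (α b - β b) := by
        simp only [map_add, map_mul, map_natCast, ← h]
        ring
      rw [sub_eq, pow_succ']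
      exact add_mem (Ideal.mul_mem_mul hp (ih a)) (Ideal.mul_mem_mul hα (ih b))
  refine RingHom.ext fun x => (IsHausdorff.eq_iff_smodEq (I := I)).2 fun n => ?_
  rw [smul_eq_mul, Ideal.mul_top, SModEq.sub_mem]
  exact sub_mem n x

theorem existsUnique_ringHom [Algebra S (ZMod p)] [IsCoefficientRing (ZMod p) S] {r : S}
    (hrm : r ∈ IsLocalRing.maximalIdeal S) (hr : (p : S) * r = 0) :
    ∃! α : PullbackRing p →+* S,
      (algebraMap S (ZMod p)).comp α = algebraMap (PullbackRing p) (ZMod p) ∧ α (t p) = r := by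
  have : IsAdicComplete (IsLocalRing.maximalIdeal S) S :=
    IsCoefficientRing.complete (k := ZMod p)
  have hpS : (p : S) ∈ IsLocalRing.maximalIdeal S := by
    rw [IsCoefficientRing.mem_maximalIdeal (ZMod p), map_natCast, ZMod.natCast_self]
  obtain ⟨α, rfl⟩ := exists_ringHom _ hpS hrm hr
  have hαt := (IsCoefficientRing.mem_maximalIdeal (ZMod p)).1 hrm
  refine ⟨α, ⟨RingHom.ext fun x => ?_, rfl⟩,
    fun β hβ => (ringHom_ext_of_isHausdorff _ hpS hrm hβ.2.symm).symm⟩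
  obtain ⟨n, a, b, rfl⟩ := exists_eq_natCast_add x
  simp [hαt, algebraMap_t]

end PullbackRing

end PowerSeries

theorem proposition2 (p : ℕ) [Fact p.Prime] (hp : 3 ≤ p) :
    ∃ (V : Type) (_ : AddCommGroup V) (_ : Module (ZMod p) V)
      (ρ : Representation (ZMod p) (DiagGroup p) V),
      IsUniserialModule (MonoidAlgebra (ZMod p) (DiagGroup p)) ρ.asModule ∧
      Module.length (MonoidAlgebra (ZMod p) (DiagGroup p)) ρ.asModule = ((p - 1 : ℕ) : ℕ∞) ∧
      Nonempty (Module.End (MonoidAlgebra (ZMod p) (DiagGroup p)) ρ.asModule ≃ₐ[ZMod p] ZMod p) ∧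
      ∃ (R : Type) (_ : CommRing R) (_ : Algebra R (ZMod p)),
        IsUniversalDeformationRing.{0, v} ρ R ∧
        Nonempty (R ≃+* ℤ_[p]⟦X⟧ ⧸ Ideal.span {PowerSeries.C (p : ℤ_[p]) * PowerSeries.X}) ∧
        ∃ _ : Algebra (ZMod p) (R ⧸ Ideal.span {(p : R)}),
          Nonempty ((R ⧸ Ideal.span {(p : R)}) ≃ₐ[ZMod p] (ZMod p)⟦X⟧) ∧
          ¬ Module.Finite (ZMod p) (R ⧸ Ideal.span {(p : R)}) :=
  ⟨AdjoinZeta p (ZMod p), inferInstance, inferInstance, AdjoinZeta.stdRep hp 0 (mul_zero _),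
    AdjoinZeta.isUniserialModule (ZMod p) hp, AdjoinZeta.length_eq (ZMod p) hp,
    AdjoinZeta.nonempty_end_algEquiv (ZMod p) hp,
    PullbackRing p, inferInstance, inferInstance,
    AdjoinZeta.isUniversalDeformationRing hp (PullbackRing.t p) PullbackRing.p_mul_t
      PullbackRing.algebraMap_t fun _ _ _ _ _ => PullbackRing.existsUnique_ringHom,
    ⟨PullbackRing.equivQuotient p⟩, PullbackRing.exists_algebra_quotient p⟩
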